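/- Let $p$ be a prime number and let $E$ be a field of characteristic $p$. For $n \geq 0$ let $\mathbf{E}_n = E((X^{1/p^n}))$, let $\mathbf{E}_\infty = \bigcup_{n \geq 0} \mathbf{E}_n$, and let $\widetilde{\mathbf{E}}$ be the $X$-adic completion of $\mathbf{E}_\infty$, with its $X$-adic valuation $\mathrm{val}_X$ normalised by $\mathrm{val}_X(X) = 1$. The group $\mathbf{Z}_p^\times$ acts on $\widetilde{\mathbf{E}}$ by isometric $E$-linear field automorphisms, the action being determined by $a \cdot X^{1/p^n} = (1+X^{1/p^n})^a - 1$ for all $n \geq 0$ and by continuity. Let $k \geq 1$, with $k \geq 2$ if $p = 2$, and let $\Gamma_k = 1 + p^k \mathbf{Z}_p$, with the coordinate $1 + p^k z \mapsto z \in \mathbf{Z}_p$. For $\lambda \in \mathbf{R}$, let $\widetilde{\mathbf{E}}^{\Gamma_k\text{-}\mathrm{sh},\lambda}$ (the super-Hölder vectors of level $\lambda$) be the set of those $f \in \widetilde{\mathbf{E}}$ for which there exists $\mu \in \mathbf{R}$ such that, for all $i \geq 0$ and all $x, y \in \mathbf{Z}_p$ with $\mathrm{val}_p(x-y) \geq i$,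 $$\mathrm{val}_X\bigl((1+p^k x) \cdot f - (1+p^k y) \cdot f\bigr) \geq p^{\lambda} \cdot p^i + \mu .$$ Let $\widetilde{\mathbf{E}}^{\mathrm{sh}} = \bigcup_{\lambda \in \mathbf{R}} \widetilde{\mathbf{E}}^{\Gamma_k\text{-}\mathrm{sh},\lambda}$ (the super-Hölder vectors of $\widetilde{\mathbf{E}}$). Then $\widetilde{\mathbf{E}}^{\Gamma_k\text{-}\mathrm{sh},\,k-m} = \mathbf{E}_m$ for all integers $m \geq 0$, and $\widetilde{\mathbf{E}}^{\mathrm{sh}} = \mathbf{E}_\infty$. -/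

import Mathlib

noncomputable section

namespace SuperHolder

/-! ### Super-Hölder functions and super-Hölder vectors -/

section General

variable (p : ℕ) [hp : Fact p.Prime]

/-- The space `ℋ^{lam,mu}(ℤ_p, M)` of functions `f : ℤ_p → M` such that
`v (f x - f y) ≥ p^lam * p^i + mu` whenever `val_p (x - y) ≥ i`, for all `x y : ℤ_p` and `i ≥ 0`.
Here `v : M → ℝ ∪ {∞}` is the valuation of `M`. -/
def holderFunctions {M : Type*} [AddCommGroup M] (v : M → WithTop ℝ) (lam mu : ℝ) :
    Set (ℤ_[p] → M) :=
  {f | ∀ (i : ℕ) (x y : ℤ_[p]), (p : ℤ_[p]) ^ i ∣ x - y →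
    (((p : ℝ) ^ lam * (p : ℝ) ^ i + mu : ℝ) : WithTop ℝ) ≤ v (f x - f y)}

/-- For a group `G` acting on `M`, with a coordinate `c : G ≃ ℤ_p`: the set `M^{G-sh,lam,mu}` of
those `m` whose orbit map `z ↦ c⁻¹(z) • m` belongs to `ℋ^{lam,mu}(ℤ_p, M)`. -/
def shVectorsOfConst {M : Type*} [AddCommGroup M] (v : M → WithTop ℝ) {G : Type*} [Group G]
    [MulAction G M] (c : G ≃ ℤ_[p]) (lam mu : ℝ) : Set M :=
  {m | (fun z : ℤ_[p] => c.symm z • m) ∈ holderFunctions p v lam mu}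

/-- The super-Hölder vectors of level `lam`: `M^{G-sh,lam}`, the union over `mu` of
`M^{G-sh,lam,mu}`. -/
def shVectorsOfLevel {M : Type*} [AddCommGroup M] (v : M → WithTop ℝ) {G : Type*} [Group G]
    [MulAction G M] (c : G ≃ ℤ_[p]) (lam : ℝ) : Set M :=
  ⋃ mu : ℝ, shVectorsOfConst p v c lam mu

/-- The super-Hölder vectors `M^{G-sh}`, the union over `lam` of `M^{G-sh,lam}`. -/
def shVectors {M : Type*} [AddCommGroup M] (v : M → WithTop ℝ) {G : Type*} [Group G]
    [MulAction G M] (c : G ≃ ℤ_[p]) : Set M :=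
  ⋃ lam : ℝ, shVectorsOfLevel p v c lam

/-- The subgroup `Γ_k = 1 + p^k ℤ_p` of `ℤ_p^×` (all of `ℤ_p^×` for `k = 0`). -/
def gammaSubgroup (k : ℕ) : Subgroup ℤ_[p]ˣ where
  carrier := {u | (p : ℤ_[p]) ^ k ∣ (u : ℤ_[p]) - 1}
  one_mem' := by simp
  mul_mem' {a b} ha hb := by
    have e : ((a * b : ℤ_[p]ˣ) : ℤ_[p]) - 1 = a * ((b : ℤ_[p]) - 1) + ((a : ℤ_[p]) - 1) := by
      push_cast; ring
    simp only [Set.mem_ofPred_eq] at ha hb ⊢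
    rw [e]
    exact dvd_add (hb.mul_left _) ha
  inv_mem' {a} ha := by
    have e : ((a⁻¹ : ℤ_[p]ˣ) : ℤ_[p]) - 1 = -((a⁻¹ : ℤ_[p]ˣ) : ℤ_[p]) * ((a : ℤ_[p]) - 1) := by
      rw [neg_mul, mul_sub, Units.inv_mul]; ring
    simp only [Set.mem_ofPred_eq] at ha ⊢
    rw [e]
    exact ha.mul_left _

theorem isUnit_one_add {k : ℕ} (hk : 1 ≤ k) (z : ℤ_[p]) : IsUnit (1 + (p : ℤ_[p]) ^ k * z) := by
  by_contra h
  have h1 : (p : ℤ_[p]) ^ k * z ∈ nonunits ℤ_[p] := fun hu =>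
    PadicInt.prime_p.not_isUnit
      (isUnit_of_dvd_unit ((dvd_pow_self _ (by omega)).mul_right z) hu)
  have h2 := IsLocalRing.nonunits_add (a := 1 + (p : ℤ_[p]) ^ k * z)
    (b := (p : ℤ_[p]) ^ k * z * (-1)) h (by
      intro hu
      exact h1 (isUnit_of_dvd_unit (Dvd.intro _ rfl) hu))
  exact h2 (by simp)

/-- The coordinate `1 + p^k z ↦ z` on `Γ_k`, for `k ≥ 1`. -/
def gammaCoord (k : ℕ) (hk : 1 ≤ k) : gammaSubgroup p k ≃ ℤ_[p] :=
  (Equiv.ofBijective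
    (fun z : ℤ_[p] => (⟨(isUnit_one_add p hk z).unit, ⟨z, by simp⟩⟩ : gammaSubgroup p k))
    ⟨fun x y hxy => by
      have h := congrArg (fun u : gammaSubgroup p k => ((u : ℤ_[p]ˣ) : ℤ_[p])) hxy
      have hp0 : (p : ℤ_[p]) ^ k ≠ 0 := pow_ne_zero _ PadicInt.prime_p.ne_zero
      simpa [hp0, hp.out.ne_zero] using h,
    fun u => by
      obtain ⟨z, hz⟩ := u.2
      refine ⟨z, Subtype.ext (Units.ext ?_)⟩
      simp [← hz]⟩).symm

theorem gammaCoord_symm_coe (k : ℕ) (hk : 1 ≤ k) (z : ℤ_[p]) :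
    (((gammaCoord p k hk).symm z : ℤ_[p]ˣ) : ℤ_[p]) = 1 + (p : ℤ_[p]) ^ k * z := rfl

end General

/-! ### The fields `E_n = E((X^{1/p^n}))`, `E_∞` and `Ẽ`

They are realised inside the field `E((X^ℚ))` of Hahn series, on which `HahnSeries.orderTop` is the
`X`-adic valuation. -/

variable (p : ℕ) [hp : Fact p.Prime] (E : Type*) [Field E]

/-- The embedding `j ↦ j / p^n` of `ℤ` in `ℚ`. -/
def divPow (n : ℕ) : ℤ →+ ℚ where
  toFun j := (j : ℚ) / (p : ℚ) ^ n
  map_zero' := by simp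
  map_add' i j := by push_cast; ring

theorem divPow_le (n : ℕ) (i j : ℤ) : divPow p n i ≤ divPow p n j ↔ i ≤ j := by
  have h : (0 : ℚ) < (p : ℚ) ^ n := by have := hp.out.pos; positivity
  simp [divPow, div_le_div_iff_of_pos_right h]

theorem divPow_injective (n : ℕ) : Function.Injective (divPow p n) := fun i j h =>
  le_antisymm ((divPow_le p n i j).1 h.le) ((divPow_le p n j i).1 h.ge)

/-- The embedding `f(X) ↦ f(X^{1/p^n})` of `E((X))` in `E((X^ℚ))`. -/
def rootHom (n : ℕ) : LaurentSeries E →+* HahnSeries ℚ E :=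
  HahnSeries.embDomainRingHom (divPow p n) (divPow_injective p n) (divPow_le p n)

/-- The field `E_n = E((X^{1/p^n}))`. -/
def levelField (n : ℕ) : Subfield (HahnSeries ℚ E) := (rootHom p E n).fieldRange

/-- The union `E_∞` of the fields `E_n = E((X^{1/p^n}))`, for `n ≥ 0`. -/
def perfField : Set (HahnSeries ℚ E) := ⋃ n, (levelField p E n : Set (HahnSeries ℚ E))

theorem rootHom_coeff (n : ℕ) (g : LaurentSeries E) (j : ℤ) :
    (rootHom p E n g).coeff (divPow p n j) = g.coeff j :=
  HahnSeries.embDomain_mk_coeff (divPow_injective p n) (divPow_le p n)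

theorem rootHom_coeff_ne {n : ℕ} {g : LaurentSeries E} {q : ℚ}
    (h : (rootHom p E n g).coeff q ≠ 0) : ∃ j, q = divPow p n j := by
  by_contra! hq
  exact h (HahnSeries.embDomain_of_notMem_range (by rintro ⟨j, rfl⟩; exact hq j rfl))

theorem mem_levelField_iff (n : ℕ) (f : HahnSeries ℚ E) :
    f ∈ levelField p E n ↔ ∀ q ∈ f.support, ∃ j, q = divPow p n j := by
  constructor
  · rintro ⟨g, rfl⟩ q hq
    exact rootHom_coeff_ne p E hq
  · intro h
    have hwf : (Function.support fun j : ℤ => f.coeff (divPow p n j)).IsPWO := by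
      refine Set.IsWF.isPWO ?_
      have h1 := f.isWF_support
      rw [Set.isWF_iff_no_descending_seq] at h1 ⊢
      intro g hg hs
      refine h1 (fun k => divPow p n (g k)) ?_ ?_
      · intro a b hab
        exact lt_of_not_ge fun hc => (hg hab).not_ge ((divPow_le p n _ _).1 hc)
      · intro k; exact hs k
    refine ⟨⟨fun j => f.coeff (divPow p n j), hwf⟩, ?_⟩
    ext q
    by_cases hq : ∃ j, q = divPow p n j
    · obtain ⟨j, rfl⟩ := hq
      exact rootHom_coeff p E n _ j
    · have h1 : f.coeff q = 0 := by
        by_contra h2; exact hq (h q h2)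
      rw [h1]
      by_contra h2
      exact hq (rootHom_coeff_ne p E h2)

theorem divPow_mul (n k : ℕ) (j : ℤ) : divPow p (n + k) (j * (p : ℤ) ^ k) = divPow p n j := by
  have h : (p : ℚ) ≠ 0 := by exact_mod_cast hp.out.ne_zero
  simp only [divPow, AddMonoidHom.coe_mk, ZeroHom.coe_mk]
  push_cast
  rw [pow_add]
  field_simp

theorem levelField_mono : Monotone (levelField p E) := by
  intro m n hmn f hf
  obtain ⟨k, rfl⟩ := Nat.exists_eq_add_of_le hmn
  rw [mem_levelField_iff] at hf ⊢
  intro q hq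
  obtain ⟨j, rfl⟩ := hf q hq
  exact ⟨_, (divPow_mul p m k j).symm⟩

/-- The field `Ẽ`, the `X`-adic completion of `E_∞`, realised as the closure of `E_∞` in `E((X^ℚ))`
for the `X`-adic valuation. It is `X`-adically complete, see `completedField_complete`. -/
def completedField : Subfield (HahnSeries ℚ E) where
  carrier := {f | ∀ c : ℚ, ∃ g ∈ perfField p E, (c : WithTop ℚ) ≤ (f - g).orderTop}
  zero_mem' c := ⟨0, Set.mem_iUnion.2 ⟨0, zero_mem _⟩, by simp⟩
  one_mem' c := ⟨1, Set.mem_iUnion.2 ⟨0, one_mem _⟩, by simp⟩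
  neg_mem' {f} hf c := by
    obtain ⟨g, hg, h⟩ := hf c
    obtain ⟨n, hn⟩ := Set.mem_iUnion.1 hg
    refine ⟨-g, Set.mem_iUnion.2 ⟨n, neg_mem hn⟩, ?_⟩
    rwa [show -f - -g = -(f - g) by ring, HahnSeries.orderTop_neg]
  add_mem' {f g} hf hg c := by
    obtain ⟨f', hf', hf⟩ := hf c
    obtain ⟨g', hg', hg⟩ := hg c
    obtain ⟨m, hm⟩ := Set.mem_iUnion.1 hf'
    obtain ⟨n, hn⟩ := Set.mem_iUnion.1 hg'
    refine ⟨f' + g', Set.mem_iUnion.2 ⟨max m n, add_mem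
      (levelField_mono p E (le_max_left m n) hm) (levelField_mono p E (le_max_right m n) hn)⟩, ?_⟩
    rw [show f + g - (f' + g') = (f - f') + (g - g') by ring]
    exact (le_min hf hg).trans HahnSeries.min_orderTop_le_orderTop_add
  mul_mem' {f g} hf hg c := by
    have bd : ∀ x : HahnSeries ℚ E, ∃ d : ℚ, (d : WithTop ℚ) ≤ x.orderTop := by
      intro x
      by_cases hx : x = 0
      · exact ⟨0, by simp [hx]⟩
      · exact ⟨x.order, (HahnSeries.order_eq_orderTop_of_ne_zero hx).le⟩
    have key : ∀ (x y : HahnSeries ℚ E) (d e : ℚ), c ≤ d + e → (d : WithTop ℚ) ≤ x.orderTop →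
        (e : WithTop ℚ) ≤ y.orderTop → (c : WithTop ℚ) ≤ (x * y).orderTop := by
      intro x y d e h1 h2 h3
      calc (c : WithTop ℚ) ≤ ((d + e : ℚ) : WithTop ℚ) := by exact_mod_cast h1
        _ ≤ x.orderTop + y.orderTop := by push_cast; exact add_le_add h2 h3
        _ ≤ _ := HahnSeries.orderTop_add_le_mul
    obtain ⟨d, hd⟩ := bd f
    obtain ⟨g', hg', hg⟩ := hg (c - d)
    obtain ⟨e, he⟩ := bd g'
    obtain ⟨f', hf', hf⟩ := hf (c - e)
    obtain ⟨m, hm⟩ := Set.mem_iUnion.1 hf'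
    obtain ⟨n, hn⟩ := Set.mem_iUnion.1 hg'
    refine ⟨f' * g', Set.mem_iUnion.2 ⟨max m n, mul_mem
      (levelField_mono p E (le_max_left m n) hm) (levelField_mono p E (le_max_right m n) hn)⟩, ?_⟩
    rw [show f * g - f' * g' = f * (g - g') + (f - f') * g' by ring]
    exact (le_min (key _ _ d (c - d) (by ring_nf; rfl) hd hg)
      (key _ _ (c - e) e (by ring_nf; rfl) hf he)).trans HahnSeries.min_orderTop_le_orderTop_add
  inv_mem' f hf c := by
    by_cases hf0 : f = 0
    · exact ⟨0, Set.mem_iUnion.2 ⟨0, zero_mem _⟩, by simp [hf0]⟩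
    obtain ⟨g, hg, h⟩ := hf (max (c + 2 * f.order) (f.order + 1))
    obtain ⟨n, hn⟩ := Set.mem_iUnion.1 hg
    refine ⟨g⁻¹, Set.mem_iUnion.2 ⟨n, inv_mem hn⟩, ?_⟩
    have hlt : f.orderTop < (f - g).orderTop := by
      rw [← HahnSeries.order_eq_orderTop_of_ne_zero hf0]
      refine lt_of_lt_of_le ?_ h
      exact_mod_cast lt_of_lt_of_le (lt_add_one _) (le_max_right _ _)
    have hfg : g.orderTop = f.orderTop := by
      have := HahnSeries.orderTop_sub hlt
      rwa [sub_sub_cancel] at this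
    have hg0 : g ≠ 0 := by
      rw [← HahnSeries.orderTop_ne_top, hfg, HahnSeries.orderTop_ne_top]; exact hf0
    have hinv : ∀ x : HahnSeries ℚ E, x ≠ 0 → x.orderTop = f.orderTop →
        x⁻¹.orderTop = ((-f.order : ℚ) : WithTop ℚ) := by
      intro x hx h1
      have h2 : x.order = f.order := by
        rw [← HahnSeries.order_eq_orderTop_of_ne_zero hx,
          ← HahnSeries.order_eq_orderTop_of_ne_zero hf0] at h1
        exact_mod_cast h1
      have h3 := HahnSeries.order_mul hx (inv_ne_zero hx)
      rw [mul_inv_cancel₀ hx, HahnSeries.order_one, h2] at h3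
      rw [← HahnSeries.order_eq_orderTop_of_ne_zero (inv_ne_zero hx)]
      exact_mod_cast (by linarith : x⁻¹.order = -f.order)
    have e : f⁻¹ - g⁻¹ = -(f⁻¹ * g⁻¹ * (f - g)) := by field_simp; ring
    rw [e, HahnSeries.orderTop_neg, HahnSeries.orderTop_mul, HahnSeries.orderTop_mul,
      hinv f hf0 rfl, hinv g hg0 hfg]
    calc (c : WithTop ℚ) = ((-f.order + -f.order + (c + 2 * f.order) : ℚ) : WithTop ℚ) := by
          congr 1; ring
      _ ≤ _ := by
        rw [WithTop.coe_add, WithTop.coe_add (-f.order)]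
        refine add_le_add le_rfl (le_trans ?_ h)
        exact_mod_cast le_max_left _ _

theorem subset_completedField : perfField p E ⊆ completedField p E :=
  fun f hf c => ⟨f, hf, by simp⟩

/-- `Ẽ` consists of the series with exponents in `ℤ[1/p]`, finitely many of them below any bound. -/
theorem mem_completedField_iff (f : HahnSeries ℚ E) :
    f ∈ completedField p E ↔
      (∀ c : ℚ, (f.support ∩ Set.Iio c).Finite) ∧ ∀ q ∈ f.support, ∃ n j, q = divPow p n j := by
  constructor
  · intro hf
    have key : ∀ c : ℚ, ∃ g ∈ perfField p E, ∀ q < c, f.coeff q = g.coeff q := by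
      intro c
      obtain ⟨g, hg, h⟩ := hf c
      refine ⟨g, hg, fun q hq => ?_⟩
      have := HahnSeries.le_orderTop_iff_forall.1 h q (by exact_mod_cast hq)
      simpa [sub_eq_zero] using this
    constructor
    · intro c
      obtain ⟨g, hg, h⟩ := key c
      obtain ⟨n, hn⟩ := Set.mem_iUnion.1 hg
      obtain ⟨g', rfl⟩ := hn
      have : f.support ∩ Set.Iio c ⊆ divPow p n '' (Set.Icc g'.order ⌈c * (p : ℚ) ^ n⌉) := by
        rintro q ⟨hq, hqc⟩
        rw [HahnSeries.mem_support, h q hqc] at hq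
        obtain ⟨j, rfl⟩ := rootHom_coeff_ne p E hq
        refine ⟨j, ⟨?_, ?_⟩, rfl⟩
        · refine HahnSeries.order_le_of_coeff_ne_zero ?_
          rw [← rootHom_coeff p E n]; exact hq
        · have h0 : (0 : ℚ) < (p : ℚ) ^ n := by have := hp.out.pos; positivity
          have h1 : (j : ℚ) / (p : ℚ) ^ n < c := hqc
          rw [div_lt_iff₀ h0] at h1
          exact_mod_cast h1.le.trans (Int.le_ceil _)
      exact ((Set.finite_Icc _ _).image _).subset this
    · intro q hq
      obtain ⟨g, hg, h⟩ := key (q + 1)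
      obtain ⟨n, hn⟩ := Set.mem_iUnion.1 hg
      rw [HahnSeries.mem_support, h q (by linarith)] at hq
      exact ⟨n, (mem_levelField_iff p E n g).1 hn q hq⟩
  · rintro ⟨hfin, hsup⟩ c
    have hex : ∀ s : Finset ℚ, (∀ q ∈ s, ∃ n j, q = divPow p n j) →
        ∃ n, ∀ q ∈ s, ∃ j, q = divPow p n j := by
      intro s
      induction s using Finset.induction_on with
      | empty => intro _; exact ⟨0, by simp⟩
      | insert a s ha ih =>
        intro h
        obtain ⟨n, hn⟩ := ih fun q hq => h q (Finset.mem_insert_of_mem hq)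
        obtain ⟨m, j, hj⟩ := h a (Finset.mem_insert_self _ _)
        refine ⟨n + m, fun q hq => ?_⟩
        rcases Finset.mem_insert.1 hq with rfl | hq
        · exact ⟨_, by rw [hj, add_comm n m]; exact (divPow_mul p m n j).symm⟩
        · obtain ⟨j', rfl⟩ := hn q hq
          exact ⟨_, (divPow_mul p n m j').symm⟩
    obtain ⟨n, hn⟩ := hex (hfin c).toFinset (by
      intro q hq
      exact hsup q ((Set.Finite.mem_toFinset _).1 hq).1)
    refine ⟨HahnSeries.truncLT c f, Set.mem_iUnion.2 ⟨n, ?_⟩, ?_⟩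
    · refine (mem_levelField_iff p E n _).2 fun q hq => hn q ?_
      rw [HahnSeries.mem_support, HahnSeries.coeff_truncLT] at hq
      rw [Set.Finite.mem_toFinset]
      by_cases h : q < c
      · rw [if_pos h] at hq; exact ⟨hq, h⟩
      · rw [if_neg h] at hq; exact absurd rfl hq
    · refine HahnSeries.le_orderTop_iff_forall.2 fun q hq => ?_
      have : q < c := by exact_mod_cast hq
      simp [HahnSeries.coeff_truncLT_of_lt this]

theorem isPWO_of_finite_Iio {s : Set ℚ} (h : ∀ c : ℚ, (s ∩ Set.Iio c).Finite) : s.IsPWO := by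
  refine Set.IsWF.isPWO ?_
  rw [Set.isWF_iff_no_descending_seq]
  intro f hf hs
  have h1 : Set.range f ⊆ insert (f 0) (s ∩ Set.Iio (f 0)) := by
    rintro _ ⟨k, rfl⟩
    rcases Nat.eq_zero_or_pos k with rfl | hk
    · exact Set.mem_insert _ _
    · exact Set.mem_insert_of_mem _ ⟨hs k, hf hk⟩
  exact Set.infinite_range_of_injective hf.injective (((h _).insert _).subset h1)

/-- `Ẽ` is complete for the `X`-adic valuation. -/
theorem completedField_complete (u : ℕ → completedField p E)
    (hu : ∀ c : ℚ, ∃ N, ∀ i ≥ N, ∀ j ≥ N,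
      (c : WithTop ℚ) ≤ ((u i : HahnSeries ℚ E) - u j).orderTop) :
    ∃ l : completedField p E, ∀ c : ℚ, ∃ N, ∀ i ≥ N,
      (c : WithTop ℚ) ≤ ((u i : HahnSeries ℚ E) - l).orderTop := by
  choose N hN using hu
  have key : ∀ c q : ℚ, q < c → ∀ i ≥ N c,
      (u i : HahnSeries ℚ E).coeff q = (u (N (q + 1)) : HahnSeries ℚ E).coeff q := by
    intro c q hq i hi
    have h1 := HahnSeries.le_orderTop_iff_forall.1
      (hN c i hi (max (N c) (N (q + 1))) (le_max_left _ _)) q (by exact_mod_cast hq)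
    have h2 := HahnSeries.le_orderTop_iff_forall.1
      (hN (q + 1) (N (q + 1)) le_rfl (max (N c) (N (q + 1))) (le_max_right _ _)) q
      (by exact_mod_cast lt_add_one q)
    rw [HahnSeries.coeff_sub, sub_eq_zero] at h1 h2
    exact h1.trans h2.symm
  let φ : ℚ → E := fun q => (u (N (q + 1)) : HahnSeries ℚ E).coeff q
  have hφ : ∀ c : ℚ, (Function.support φ ∩ Set.Iio c).Finite := by
    intro c
    refine (((mem_completedField_iff p E _).1 (u (N c)).2).1 c).subset ?_
    rintro q ⟨h1, h2⟩
    refine ⟨?_, h2⟩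
    rw [HahnSeries.mem_support, key c q h2 _ le_rfl]
    exact h1
  refine ⟨⟨⟨φ, isPWO_of_finite_Iio hφ⟩, (mem_completedField_iff p E _).2 ⟨hφ, ?_⟩⟩, ?_⟩
  · intro q hq
    exact ((mem_completedField_iff p E _).1 (u (N (q + 1))).2).2 q hq
  · intro c
    refine ⟨N c, fun i hi => HahnSeries.le_orderTop_iff_forall.2 fun q hq => ?_⟩
    rw [HahnSeries.coeff_sub, sub_eq_zero]
    exact key c q (by exact_mod_cast hq) i hi


theorem rootHom_succ (n : ℕ) (g : PowerSeries E) :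
    rootHom p E (n + 1) ((PowerSeries.expand p hp.out.ne_zero g : PowerSeries E) : LaurentSeries E)
      = rootHom p E n (g : LaurentSeries E) := by
  have hmul : ∀ j : ℤ, divPow p (n + 1) (j * p) = divPow p n j := by
    intro j; simpa using divPow_mul p n 1 j
  ext q
  by_cases hq : ∃ j, q = divPow p (n + 1) j
  · obtain ⟨j, rfl⟩ := hq
    rw [rootHom_coeff]
    by_cases hj : (p : ℤ) ∣ j
    · obtain ⟨k, rfl⟩ := hj
      rw [mul_comm, hmul, rootHom_coeff]
      have hp0 : (0 : ℤ) < p := by exact_mod_cast hp.out.pos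
      rcases lt_or_ge k 0 with hk | hk
      · rw [PowerSeries.coeff_coe, PowerSeries.coeff_coe, if_pos hk,
          if_pos (mul_neg_of_neg_of_pos hk hp0)]
      · obtain ⟨k, rfl⟩ := Int.eq_ofNat_of_zero_le hk
        rw [← Nat.cast_mul, LaurentSeries.coeff_coe_powerSeries,
          LaurentSeries.coeff_coe_powerSeries, mul_comm, PowerSeries.coeff_expand_mul]
    · have h1 : ((PowerSeries.expand p hp.out.ne_zero g : PowerSeries E) : LaurentSeries E).coeff j
          = 0 := by
        rw [PowerSeries.coeff_coe]
        split_ifs with h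
        · rfl
        · refine PowerSeries.coeff_expand_of_not_dvd p _ _ fun hd => hj ?_
          have := Int.natCast_dvd_natCast.2 hd
          rwa [Int.natAbs_of_nonneg (not_lt.1 h)] at this
      rw [h1]
      by_contra h2
      obtain ⟨i, hi⟩ := rootHom_coeff_ne p E (Ne.symm h2)
      rw [← hmul] at hi
      exact hj ⟨i, by rw [divPow_injective p _ hi, mul_comm]⟩
  · have h1 : ∀ m (_ : m ≤ n + 1) (g : LaurentSeries E), (rootHom p E m g).coeff q = 0 := by
      intro m hm g
      by_contra h
      obtain ⟨j, rfl⟩ := rootHom_coeff_ne p E h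
      obtain ⟨k, hk⟩ := Nat.exists_eq_add_of_le hm
      exact hq ⟨j * p ^ k, by rw [hk, divPow_mul]⟩
    rw [h1 _ le_rfl, h1 n (Nat.le_succ n)]

theorem rootHom_single (n : ℕ) (j : ℤ) (c : E) :
    rootHom p E n (HahnSeries.single j c) = HahnSeries.single (divPow p n j) c :=
  HahnSeries.embDomain_single

/-- `c X^{j/p^n}` -/
def monomial (n : ℕ) (j : ℤ) (c : E) : completedField p E :=
  ⟨rootHom p E n (HahnSeries.single j c),
    subset_completedField p E (Set.mem_iUnion.2 ⟨n, RingHom.mem_fieldRange_self _ _⟩)⟩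

theorem monomial_coe (n : ℕ) (j : ℤ) (c : E) :
    (monomial p E n j c : HahnSeries ℚ E) = HahnSeries.single (divPow p n j) c :=
  rootHom_single p E n j c

/-- The `X`-adic valuation `val_X` on `Ẽ`, normalised by `val_X(X) = 1`, with `val_X(0) = ∞`. -/
def valX (f : completedField p E) : WithTop ℝ :=
  (f : HahnSeries ℚ E).orderTop.map ((↑) : ℚ → ℝ)

/-! ### The action of `ℤ_p^×` on `Ẽ` -/

section Action

variable [CharP E p]

/-- The power series `(1 + X)^a = ∑ binom(a, n) X^n` with coefficients in `𝔽_p ⊆ E`. -/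
def onePlusPow (a : ℤ_[p]) : PowerSeries E :=
  PowerSeries.map ((ZMod.castHom dvd_rfl E).comp PadicInt.toZMod)
    (PowerSeries.binomialSeries ℤ_[p] a)

/-- The power series `(1 + X)^a - 1`. -/
def gammaSeries (a : ℤ_[p]) : PowerSeries E := onePlusPow p E a - 1

/-- The result of the substitution of `(1 + X^{1/p^n})^a - 1` for `X^{1/p^n}` in `X^q`: for
`q = j / p^n` it is `((1 + X^{1/p^n})^a - 1)^j`. Here it is written for the reduced fraction `q`; see
`substMonomial_divPow` for the independence of that choice. (It is only used for `q ∈ ℤ[1/p]`.) -/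
def substMonomial (a : ℤ_[p]) (q : ℚ) : HahnSeries ℚ E :=
  rootHom p E (padicValNat p q.den) ((gammaSeries p E a : LaurentSeries E) ^ q.num)

theorem onePlusPow_add (a b : ℤ_[p]) :
    onePlusPow p E (a + b) = onePlusPow p E a * onePlusPow p E b := by
  simp [onePlusPow]

theorem onePlusPow_natCast (n : ℕ) :
    onePlusPow p E (n : ℤ_[p]) = (1 + PowerSeries.X) ^ n := by
  simp [onePlusPow]

theorem onePlusPow_nsmul (n : ℕ) (a : ℤ_[p]) :
    onePlusPow p E (n * a) = onePlusPow p E a ^ n := by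
  induction n with
  | zero => simpa using onePlusPow_natCast p E 0
  | succ n ih => rw [Nat.cast_succ, add_mul, one_mul, onePlusPow_add, ih, pow_succ]

theorem gammaSeries_coeff_zero (a : ℤ_[p]) : (gammaSeries p E a).coeff 0 = 0 := by
  have h : (onePlusPow p E a).coeff 0 = 1 := by
    rw [onePlusPow, PowerSeries.coeff_map, PowerSeries.binomialSeries_coeff]
    simp
  rw [gammaSeries, map_sub, h]
  simp

theorem gammaSeries_coeff_one (a : ℤ_[p]) :
    (gammaSeries p E a).coeff 1 = ZMod.castHom dvd_rfl E (PadicInt.toZMod a) := by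
  simp [gammaSeries, onePlusPow, PowerSeries.coeff_one]

theorem gammaSeries_coeff_one_ne (a : ℤ_[p]ˣ) : (gammaSeries p E a).coeff 1 ≠ 0 := by
  rw [gammaSeries_coeff_one]
  exact ((a.isUnit.map PadicInt.toZMod).map _).ne_zero

theorem gammaSeries_pow (a : ℤ_[p]) :
    gammaSeries p E a ^ p = PowerSeries.expand p hp.out.ne_zero (gammaSeries p E a) := by
  have h1 : PowerSeries.map (frobenius E p)
      (PowerSeries.expand p hp.out.ne_zero (gammaSeries p E a)) = gammaSeries p E a ^ p :=
    MvPowerSeries.map_frobenius_expand p hp.out.ne_zero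
  rw [← h1]
  have h2 : ∀ x : ℤ_[p], frobenius E p (ZMod.castHom dvd_rfl E (PadicInt.toZMod x)) =
      ZMod.castHom dvd_rfl E (PadicInt.toZMod x) := by
    intro x
    rw [← RingHom.map_frobenius, ZMod.frobenius_zmod, RingHom.id_apply]
  have h3 : PowerSeries.map (frobenius E p) (gammaSeries p E a) = gammaSeries p E a := by
    ext n
    simp only [gammaSeries, onePlusPow, map_sub, map_one, PowerSeries.coeff_map,
      RingHom.comp_apply, h2]
  rw [PowerSeries.map_expand, h3]

theorem rootHom_gamma (n k : ℕ) (a : ℤ_[p]) (j : ℤ) :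
    rootHom p E (n + k) ((gammaSeries p E a : LaurentSeries E) ^ (j * (p : ℤ) ^ k)) =
      rootHom p E n ((gammaSeries p E a : LaurentSeries E) ^ j) := by
  induction k with
  | zero => simp
  | succ k ih =>
    rw [← ih, pow_succ, ← mul_assoc, mul_comm _ (p : ℤ), zpow_mul, zpow_natCast, map_zpow₀,
      map_zpow₀, ← PowerSeries.coe_pow, gammaSeries_pow, ← add_assoc, rootHom_succ]

theorem substMonomial_divPow (a : ℤ_[p]) (n : ℕ) (j : ℤ) :
    substMonomial p E a (divPow p n j) =
      rootHom p E n ((gammaSeries p E a : LaurentSeries E) ^ j) := by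
  set q := divPow p n j with hq
  have hpn : ((p : ℤ) ^ n) ≠ 0 := pow_ne_zero _ (by exact_mod_cast hp.out.ne_zero)
  have hqd : q = Rat.divInt j ((p : ℤ) ^ n) := by
    rw [hq, Rat.divInt_eq_div]; simp [divPow]
  have hden : q.den ∣ p ^ n := by
    have := Rat.den_dvd j ((p : ℤ) ^ n)
    rw [← hqd] at this
    exact_mod_cast this
  obtain ⟨m, hm, hm'⟩ := (Nat.dvd_prime_pow hp.out).1 hden
  obtain ⟨k, rfl⟩ := Nat.exists_eq_add_of_le hm
  have h1 : q = divPow p m q.num := by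
    conv_lhs => rw [← Rat.num_div_den q]
    simp [divPow, hm']
  have h2 : j = q.num * (p : ℤ) ^ k := by
    apply divPow_injective p (m + k)
    rw [divPow_mul, ← h1]
  have h3 : padicValNat p q.den = m := by rw [hm']; exact padicValNat.prime_pow m
  rw [substMonomial, h3, h2, rootHom_gamma]

theorem gamma_ne_zero (a : ℤ_[p]ˣ) : (gammaSeries p E a : LaurentSeries E) ≠ 0 := by
  intro h
  apply gammaSeries_coeff_one_ne p E a
  rw [← LaurentSeries.coeff_coe_powerSeries, h, HahnSeries.coeff_zero]

theorem gamma_order (a : ℤ_[p]ˣ) : (gammaSeries p E a : LaurentSeries E).order = 1 := by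
  refine le_antisymm ?_ ?_
  · refine HahnSeries.order_le_of_coeff_ne_zero ?_
    have := LaurentSeries.coeff_coe_powerSeries (gammaSeries p E a) 1
    rw [Nat.cast_one] at this
    rw [this]
    exact gammaSeries_coeff_one_ne p E a
  · refine (HahnSeries.le_order_iff_forall (gamma_ne_zero p E a)).2 fun j hj => ?_
    rw [PowerSeries.coeff_coe]
    split_ifs with h
    · rfl
    · have : j = 0 := by omega
      subst this
      exact gammaSeries_coeff_zero p E a

theorem gamma_zpow_order (a : ℤ_[p]ˣ) (j : ℤ) :
    ((gammaSeries p E a : LaurentSeries E) ^ j).order = j := by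
  have hnat : ∀ n : ℕ, ((gammaSeries p E a : LaurentSeries E) ^ n).order = n := by
    intro n
    rw [HahnSeries.order_pow, gamma_order]
    simp
  obtain ⟨n, rfl | rfl⟩ := j.eq_nat_or_neg
  · rw [zpow_natCast, hnat]
  · have h0 : (gammaSeries p E a : LaurentSeries E) ^ n ≠ 0 := pow_ne_zero _ (gamma_ne_zero p E a)
    have h := HahnSeries.order_mul h0 (inv_ne_zero h0)
    rw [mul_inv_cancel₀ h0, HahnSeries.order_one, hnat] at h
    rw [zpow_neg, zpow_natCast]
    omega

theorem substMonomial_orderTop (a : ℤ_[p]ˣ) {q : ℚ} (hq : ∃ n j, q = divPow p n j) :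
    (substMonomial p E a q).orderTop = q := by
  obtain ⟨n, j, rfl⟩ := hq
  rw [substMonomial_divPow]
  have h := HahnSeries.orderTop_embDomain (f := ⟨⟨divPow p n, divPow_injective p n⟩,
    divPow_le p n _ _⟩) (x := (gammaSeries p E a : LaurentSeries E) ^ j)
  refine Eq.trans h ?_
  rw [← HahnSeries.order_eq_orderTop_of_ne_zero (zpow_ne_zero _ (gamma_ne_zero p E a)),
    gamma_zpow_order]
  rfl

theorem exists_divPow_add {q r : ℚ} (hq : ∃ n j, q = divPow p n j) (hr : ∃ n j, r = divPow p n j) :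
    ∃ n i j, q = divPow p n i ∧ r = divPow p n j := by
  obtain ⟨m, i, rfl⟩ := hq
  obtain ⟨n, j, rfl⟩ := hr
  exact ⟨m + n, _, _, (divPow_mul p m n i).symm, by
    rw [add_comm m n]; exact (divPow_mul p n m j).symm⟩

theorem substMonomial_add (a : ℤ_[p]ˣ) {q r : ℚ} (hq : ∃ n j, q = divPow p n j)
    (hr : ∃ n j, r = divPow p n j) :
    substMonomial p E a (q + r) = substMonomial p E a q * substMonomial p E a r := by
  obtain ⟨n, i, j, rfl, rfl⟩ := exists_divPow_add p hq hr
  rw [← map_add, substMonomial_divPow, substMonomial_divPow, substMonomial_divPow,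
    zpow_add₀ (gamma_ne_zero p E a), map_mul]

theorem substMonomial_zero (a : ℤ_[p]) : substMonomial p E a 0 = 1 := by
  have := substMonomial_divPow p E a 0 0
  rwa [map_zero, zpow_zero, map_one] at this

theorem substMonomial_mem (a : ℤ_[p]) (q : ℚ) :
    substMonomial p E a q ∈ completedField p E :=
  subset_completedField p E (Set.mem_iUnion.2 ⟨_, RingHom.mem_fieldRange_self _ _⟩)

theorem substMonomial_coeff_eq_zero (a : ℤ_[p]ˣ) {q r : ℚ} (hq : ∃ n j, q = divPow p n j)
    (h : r < q) : (substMonomial p E a q).coeff r = 0 :=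
  HahnSeries.coeff_eq_zero_of_lt_orderTop (by
    rw [substMonomial_orderTop p E a hq]; exact_mod_cast h)

theorem coeff_smul_ne (a : ℤ_[p]ˣ) (f : completedField p E) {q r : ℚ}
    (h : (HahnSeries.C ((f : HahnSeries ℚ E).coeff q) * substMonomial p E a q).coeff r ≠ 0) :
    q ∈ (f : HahnSeries ℚ E).support ∧ q ≤ r ∧ r ∈ (substMonomial p E a q).support := by
  rw [HahnSeries.C_mul_eq_smul, HahnSeries.coeff_smul, smul_eq_mul] at h
  have h1 := left_ne_zero_of_mul h
  refine ⟨h1, not_lt.1 fun hlt => right_ne_zero_of_mul h ?_, right_ne_zero_of_mul h⟩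
  exact substMonomial_coeff_eq_zero p E a (((mem_completedField_iff p E _).1 f.2).2 q h1) hlt

theorem support_finite (a : ℤ_[p]ˣ) (f : completedField p E) (c : ℚ) :
    ((⋃ q : ℚ, (HahnSeries.C ((f : HahnSeries ℚ E).coeff q) *
      substMonomial p E a q).support) ∩ Set.Iio c).Finite := by
  refine ((((mem_completedField_iff p E _).1 f.2).1 c).biUnion (t := fun q =>
    (substMonomial p E a q).support ∩ Set.Iio c) fun q _ =>
      ((mem_completedField_iff p E _).1 (substMonomial_mem p E a q)).1 c).subset ?_
  rintro r ⟨hr, hrc⟩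
  obtain ⟨q, hq⟩ := Set.mem_iUnion.1 hr
  obtain ⟨h1, h2, h3⟩ := coeff_smul_ne p E a f hq
  exact Set.mem_biUnion (⟨h1, lt_of_le_of_lt h2 hrc⟩ : q ∈ _ ∩ Set.Iio c) ⟨h3, hrc⟩

/-- The summable family of the `f_q · (a · X^q)`, for `f = ∑ f_q X^q` in `Ẽ`. -/
def substFamily (a : ℤ_[p]ˣ) (f : completedField p E) : HahnSeries.SummableFamily ℚ E ℚ where
  toFun q := HahnSeries.C ((f : HahnSeries ℚ E).coeff q) * substMonomial p E a q
  isPWO_iUnion_support' := isPWO_of_finite_Iio (support_finite p E a f)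
  finite_co_support' r := (((mem_completedField_iff p E _).1 f.2).1 (r + 1)).subset fun q hq => by
    obtain ⟨h1, h2, -⟩ := coeff_smul_ne p E a f hq
    exact ⟨h1, lt_of_le_of_lt h2 (lt_add_one r)⟩

theorem hsum_substFamily_mem (a : ℤ_[p]ˣ) (f : completedField p E) :
    (substFamily p E a f).hsum ∈ completedField p E := by
  rw [mem_completedField_iff]
  refine ⟨fun c => (support_finite p E a f c).subset (Set.inter_subset_inter_left _
    HahnSeries.SummableFamily.support_hsum_subset), fun r hr => ?_⟩
  obtain ⟨q, hq⟩ := Set.mem_iUnion.1 (HahnSeries.SummableFamily.support_hsum_subset hr)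
  exact ((mem_completedField_iff p E _).1 (substMonomial_mem p E a q)).2 r
    (coeff_smul_ne p E a f hq).2.2

theorem coeff_hsum_substFamily (a : ℤ_[p]ˣ) (f : completedField p E) (r : ℚ) (s : Finset ℚ)
    (hs : ∀ q ∈ (f : HahnSeries ℚ E).support, q ≤ r → q ∈ s) :
    (substFamily p E a f).hsum.coeff r =
      ∑ q ∈ s, (f : HahnSeries ℚ E).coeff q * (substMonomial p E a q).coeff r := by
  rw [HahnSeries.SummableFamily.coeff_hsum_eq_sum_of_subset (t := s)]
  · refine Finset.sum_congr rfl fun q _ => ?_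
    change (HahnSeries.C _ * _ : HahnSeries ℚ E).coeff r = _
    rw [HahnSeries.C_mul_eq_smul, HahnSeries.coeff_smul, smul_eq_mul]
  · intro q hq
    obtain ⟨h1, h2, -⟩ := coeff_smul_ne p E a f hq
    exact hs q h1 h2

/-- The ring endomorphism `f(X) ↦ f((1 + X)^a - 1)` of `Ẽ`, that is
`∑ f_q X^q ↦ ∑ f_q (a · X^q)`. -/
def substHom (a : ℤ_[p]ˣ) : completedField p E →+* completedField p E where
  toFun f := ⟨(substFamily p E a f).hsum, hsum_substFamily_mem p E a f⟩
  map_zero' := by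
    apply Subtype.ext
    ext r
    exact coeff_hsum_substFamily p E a 0 r ∅ (by simp)
  map_one' := by
    apply Subtype.ext
    ext r
    refine (coeff_hsum_substFamily p E a 1 r {0} ?_).trans ?_
    · intro q hq _
      by_contra h
      exact hq (by simpa [HahnSeries.coeff_one] using h)
    · simp [substMonomial_zero]
  map_add' f g := by
    apply Subtype.ext
    ext r
    have hf := (((mem_completedField_iff p E _).1 f.2).1 (r + 1))
    have hg := (((mem_completedField_iff p E _).1 g.2).1 (r + 1))
    have h1 := coeff_hsum_substFamily p E a f r (hf.toFinset ∪ hg.toFinset) (fun q h1 h2 => by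
      simp only [Finset.mem_union, Set.Finite.mem_toFinset]
      exact Or.inl ⟨h1, lt_of_le_of_lt h2 (lt_add_one r)⟩)
    have h2 := coeff_hsum_substFamily p E a g r (hf.toFinset ∪ hg.toFinset) (fun q h1 h2 => by
      simp only [Finset.mem_union, Set.Finite.mem_toFinset]
      exact Or.inr ⟨h1, lt_of_le_of_lt h2 (lt_add_one r)⟩)
    have h3 := coeff_hsum_substFamily p E a (f + g) r (hf.toFinset ∪ hg.toFinset)
      (fun q h1 h2 => by
        simp only [Finset.mem_union, Set.Finite.mem_toFinset]
        rcases HahnSeries.support_add_subset _ _ h1 with h | h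
        · exact Or.inl ⟨h, lt_of_le_of_lt h2 (lt_add_one r)⟩
        · exact Or.inr ⟨h, lt_of_le_of_lt h2 (lt_add_one r)⟩)
    refine h3.trans ?_
    change _ = (substFamily p E a f).hsum.coeff r + (substFamily p E a g).hsum.coeff r
    rw [h1, h2, ← Finset.sum_add_distrib]
    exact Finset.sum_congr rfl fun q _ => add_mul _ _ _
  map_mul' f g := by
    apply Subtype.ext
    change (substFamily p E a (f * g)).hsum =
      (substFamily p E a f).hsum * (substFamily p E a g).hsum
    rw [← HahnSeries.SummableFamily.hsum_mul]
    ext r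
    have hD : ∀ {x : completedField p E} {q : ℚ}, q ∈ (x : HahnSeries ℚ E).support →
        ∃ n j, q = divPow p n j := fun {x q} h => ((mem_completedField_iff p E _).1 x.2).2 q h
    have hA := ((mem_completedField_iff p E _).1 f.2).1 (r - (g : HahnSeries ℚ E).order + 1)
    have hB := ((mem_completedField_iff p E _).1 g.2).1 (r - (f : HahnSeries ℚ E).order + 1)
    have hAB : ∀ q q' : ℚ, q ∈ (f : HahnSeries ℚ E).support → q' ∈ (g : HahnSeries ℚ E).support →
        q + q' ≤ r → (q, q') ∈ hA.toFinset ×ˢ hB.toFinset := by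
      intro q q' h1 h2 h3
      have h4 := HahnSeries.order_le_of_coeff_ne_zero h1
      have h5 := HahnSeries.order_le_of_coeff_ne_zero h2
      rw [Finset.mem_product, Set.Finite.mem_toFinset, Set.Finite.mem_toFinset]
      exact ⟨⟨h1, by rw [Set.mem_Iio]; linarith⟩, ⟨h2, by rw [Set.mem_Iio]; linarith⟩⟩
    have hterm : ∀ q q' : ℚ, q ∈ (f : HahnSeries ℚ E).support → q' ∈ (g : HahnSeries ℚ E).support →
        (HahnSeries.C ((f : HahnSeries ℚ E).coeff q) * substMonomial p E a q *
          (HahnSeries.C ((g : HahnSeries ℚ E).coeff q') * substMonomial p E a q')).coeff r =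
        (f : HahnSeries ℚ E).coeff q * (g : HahnSeries ℚ E).coeff q' *
          (substMonomial p E a (q + q')).coeff r := by
      intro q q' h1 h2
      rw [mul_mul_mul_comm, ← map_mul, ← substMonomial_add p E a (hD h1) (hD h2),
        HahnSeries.C_mul_eq_smul, HahnSeries.coeff_smul, smul_eq_mul]
    rw [HahnSeries.SummableFamily.coeff_hsum_eq_sum_of_subset (t := hA.toFinset ×ˢ hB.toFinset)]
    · rw [coeff_hsum_substFamily p E a (f * g) r
        ((hA.toFinset ×ˢ hB.toFinset).image fun x => x.1 + x.2)]
      · rw [← Finset.sum_fiberwise_of_maps_to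
          (t := (hA.toFinset ×ˢ hB.toFinset).image fun x => x.1 + x.2)
          (g := fun x : ℚ × ℚ => x.1 + x.2) (fun x hx => Finset.mem_image_of_mem _ hx)]
        refine Finset.sum_congr rfl fun Q hQ => ?_
        have hr : ∑ x ∈ (hA.toFinset ×ˢ hB.toFinset) with x.1 + x.2 = Q,
            (((substFamily p E a f).mul (substFamily p E a g)) x).coeff r =
            ∑ x ∈ (hA.toFinset ×ˢ hB.toFinset) with x.1 + x.2 = Q,
              ((f : HahnSeries ℚ E).coeff x.1 * (g : HahnSeries ℚ E).coeff x.2) *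
                (substMonomial p E a Q).coeff r := by
          refine Finset.sum_congr rfl fun x hx => ?_
          rw [Finset.mem_filter, Finset.mem_product, Set.Finite.mem_toFinset,
            Set.Finite.mem_toFinset] at hx
          rw [← hx.2]
          exact hterm x.1 x.2 hx.1.1.1 hx.1.2.1
        rw [hr, ← Finset.sum_mul]
        rcases lt_or_ge r Q with hlt | hle
        · have hQD : ∃ n j, Q = divPow p n j := by
            obtain ⟨x, hx, rfl⟩ := Finset.mem_image.1 hQ
            rw [Finset.mem_product, Set.Finite.mem_toFinset, Set.Finite.mem_toFinset] at hx
            obtain ⟨n, i, j, h1, h2⟩ := exists_divPow_add p (hD hx.1.1) (hD hx.2.1)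
            exact ⟨n, i + j, by rw [h1, h2, map_add]⟩
          rw [substMonomial_coeff_eq_zero p E a hQD hlt, mul_zero, mul_zero]
        · congr 1
          refine HahnSeries.coeff_mul.trans (Finset.sum_congr ?_ fun _ _ => rfl)
          ext ⟨q, q'⟩
          rw [Finset.mem_antidiagonal, Finset.mem_filter]
          constructor
          · rintro ⟨h1, h2, h3⟩
            exact ⟨hAB q q' h1 h2 (h3.le.trans hle), h3⟩
          · rintro ⟨h1, h3⟩
            rw [Finset.mem_product, Set.Finite.mem_toFinset, Set.Finite.mem_toFinset] at h1
            exact ⟨h1.1.1, h1.2.1, h3⟩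
      · intro Q hQ hQr
        obtain ⟨q, h1, q', h2, rfl⟩ := HahnSeries.support_mul_subset hQ
        exact Finset.mem_image.2 ⟨(q, q'), hAB q q' h1 h2 hQr, rfl⟩
    · rintro ⟨q, q'⟩ hx
      have hx' : (HahnSeries.C ((f : HahnSeries ℚ E).coeff q) * substMonomial p E a q *
          (HahnSeries.C ((g : HahnSeries ℚ E).coeff q') * substMonomial p E a q')).coeff r ≠ 0 := hx
      have h1 : q ∈ (f : HahnSeries ℚ E).support := by
        intro h
        change (f : HahnSeries ℚ E).coeff q = 0 at h
        apply hx'; rw [h]; simp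
      have h2 : q' ∈ (g : HahnSeries ℚ E).support := by
        intro h
        change (g : HahnSeries ℚ E).coeff q' = 0 at h
        apply hx'; rw [h]; simp
      rw [hterm q q' h1 h2] at hx'
      refine hAB q q' h1 h2 (not_lt.1 fun hlt => right_ne_zero_of_mul hx' ?_)
      obtain ⟨n, i, j, h3, h4⟩ := exists_divPow_add p (hD h1) (hD h2)
      exact substMonomial_coeff_eq_zero p E a ⟨n, i + j, by rw [h3, h4, map_add]⟩ hlt

theorem substHom_coe (a : ℤ_[p]ˣ) (f : completedField p E) :
    (substHom p E a f : HahnSeries ℚ E) = (substFamily p E a f).hsum := rfl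

theorem substHom_monomial (a : ℤ_[p]ˣ) (n : ℕ) (j : ℤ) (c : E) :
    (substHom p E a (monomial p E n j c) : HahnSeries ℚ E) =
      HahnSeries.C c * rootHom p E n ((gammaSeries p E a : LaurentSeries E) ^ j) := by
  ext r
  rw [substHom_coe, coeff_hsum_substFamily p E a _ r {divPow p n j}, Finset.sum_singleton]
  · rw [monomial_coe, HahnSeries.coeff_single_same, substMonomial_divPow,
      HahnSeries.C_mul_eq_smul, HahnSeries.coeff_smul, smul_eq_mul]
  · intro q hq _
    rw [monomial_coe] at hq
    exact Finset.mem_singleton.2 (HahnSeries.eq_of_mem_support_single hq)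

theorem substHom_le_orderTop (a : ℤ_[p]ˣ) (f : completedField p E) :
    (f : HahnSeries ℚ E).orderTop ≤ (substHom p E a f : HahnSeries ℚ E).orderTop := by
  refine HahnSeries.le_orderTop_iff_forall.2 fun r hr => ?_
  rw [substHom_coe, coeff_hsum_substFamily p E a f r ∅, Finset.sum_empty]
  intro q hq hqr
  exact absurd (HahnSeries.coeff_eq_zero_of_lt_orderTop (lt_of_le_of_lt (by exact_mod_cast hqr) hr))
    hq

theorem substHom_ext {φ ψ : completedField p E →+* completedField p E}
    (hφ : ∀ f : completedField p E, (f : HahnSeries ℚ E).orderTop ≤ (φ f : HahnSeries ℚ E).orderTop)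
    (hψ : ∀ f : completedField p E, (f : HahnSeries ℚ E).orderTop ≤ (ψ f : HahnSeries ℚ E).orderTop)
    (hC : ∀ c, φ (monomial p E 0 0 c) = ψ (monomial p E 0 0 c))
    (hX : ∀ n, φ (monomial p E n 1 1) = ψ (monomial p E n 1 1)) : φ = ψ := by
  have hmon : ∀ n j c, φ (monomial p E n j c) = ψ (monomial p E n j c) := by
    intro n j c
    have : monomial p E n j c = monomial p E 0 0 c * monomial p E n 1 1 ^ j := by
      apply Subtype.ext
      have h1 : ((monomial p E n 1 1 ^ j : completedField p E) : HahnSeries ℚ E) =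
          rootHom p E n (HahnSeries.single 1 1) ^ j :=
        map_zpow₀ (completedField p E).subtype _ _
      change (monomial p E n j c : HahnSeries ℚ E) = (monomial p E 0 0 c : HahnSeries ℚ E) *
        ((monomial p E n 1 1 ^ j : completedField p E) : HahnSeries ℚ E)
      rw [h1, ← map_zpow₀, ← RatFunc.single_zpow, rootHom_single, monomial_coe, monomial_coe,
        HahnSeries.single_mul_single]
      simp
    rw [this, map_mul, map_mul, map_zpow₀, map_zpow₀, hC, hX]
  let S : Subring (completedField p E) := RingHom.eqLocus φ ψ
  have hpoly : ∀ s : Finset ℚ, ∀ f : completedField p E, (f : HahnSeries ℚ E).support ⊆ s →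
      φ f = ψ f := by
    intro s
    induction s using Finset.induction_on with
    | empty =>
      intro f hf
      have : f = 0 := by
        apply Subtype.ext
        exact HahnSeries.support_eq_empty_iff.1 (Set.subset_empty_iff.1 (by simpa using hf))
      rw [this, map_zero, map_zero]
    | insert q s hqs ih =>
      intro f hf
      by_cases hq : q ∈ (f : HahnSeries ℚ E).support
      · obtain ⟨n, j, rfl⟩ := ((mem_completedField_iff p E _).1 f.2).2 q hq
        set m := monomial p E n j ((f : HahnSeries ℚ E).coeff (divPow p n j)) with hm
        have h1 : φ (f - m) = ψ (f - m) := by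
          apply ih
          intro r hr
          have hrm : (m : HahnSeries ℚ E) = HahnSeries.single (divPow p n j)
            ((f : HahnSeries ℚ E).coeff (divPow p n j)) := rootHom_single p E n j _
          have hr' : (f : HahnSeries ℚ E).coeff r - (m : HahnSeries ℚ E).coeff r ≠ 0 := hr
          rw [hrm] at hr'
          by_cases h : r = divPow p n j
          · subst h
            rw [HahnSeries.coeff_single_same, sub_self] at hr'
            exact absurd rfl hr'
          · rw [HahnSeries.coeff_single_of_ne h, sub_zero] at hr'
            have := hf hr'
            rw [Finset.mem_coe, Finset.mem_insert] at this
            exact this.resolve_left h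
        rw [← sub_add_cancel f m, map_add, map_add, h1, hmon]
      · exact ih f fun r hr => by
          have := hf hr
          rw [Finset.mem_coe, Finset.mem_insert] at this
          exact this.resolve_left fun h => hq (h ▸ hr)
  ext1 f
  apply Subtype.ext
  rw [← sub_eq_zero]
  rw [← HahnSeries.orderTop_eq_top, ← top_le_iff]
  refine le_of_forall_lt fun c hc => ?_
  lift c to ℚ using hc.ne
  refine lt_of_lt_of_le (b := ((c + 1 : ℚ) : WithTop ℚ)) (by exact_mod_cast lt_add_one c) ?_
  have hfc := ((mem_completedField_iff p E _).1 f.2)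
  let t : completedField p E := ⟨HahnSeries.truncLT (c + 1) (f : HahnSeries ℚ E), by
    rw [mem_completedField_iff]
    have hs := HahnSeries.support_truncLT_subset (c + 1) (f : HahnSeries ℚ E)
    exact ⟨fun d => (hfc.1 d).subset (Set.inter_subset_inter_left _ hs), fun q hq => hfc.2 q (hs hq)⟩⟩
  have ht : φ t = ψ t := hpoly (hfc.1 (c + 1)).toFinset t (by
    intro q hq
    rw [Set.Finite.coe_toFinset]
    have hq' : (HahnSeries.truncLT (c + 1) (f : HahnSeries ℚ E)).coeff q ≠ 0 := hq
    rw [HahnSeries.coeff_truncLT] at hq'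
    by_cases h : q < c + 1
    · rw [if_pos h] at hq'; exact ⟨hq', h⟩
    · rw [if_neg h] at hq'; exact absurd rfl hq')
  have hft : ((c + 1 : ℚ) : WithTop ℚ) ≤ ((f - t : completedField p E) : HahnSeries ℚ E).orderTop := by
    refine HahnSeries.le_orderTop_iff_forall.2 fun q hq => ?_
    have : q < c + 1 := by exact_mod_cast hq
    change (f : HahnSeries ℚ E).coeff q -
      (HahnSeries.truncLT (c + 1) (f : HahnSeries ℚ E)).coeff q = 0
    rw [HahnSeries.coeff_truncLT_of_lt this, sub_self]
  have e : (φ f : HahnSeries ℚ E) - ψ f =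
      (φ (f - t) : HahnSeries ℚ E) - (ψ (f - t) : HahnSeries ℚ E) := by
    rw [map_sub, map_sub, ht]
    push_cast
    ring
  rw [e]
  exact (le_min (hft.trans (hφ _)) (hft.trans (hψ _))).trans
    HahnSeries.min_orderTop_le_orderTop_sub

theorem substHom_const (a : ℤ_[p]ˣ) (c : E) :
    substHom p E a (monomial p E 0 0 c) = monomial p E 0 0 c := by
  apply Subtype.ext
  rw [substHom_monomial, zpow_zero, map_one, mul_one]
  change _ = rootHom p E 0 (HahnSeries.single 0 c)
  rw [rootHom_single, map_zero]
  rfl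

/-- `(1 + X^{1/p^n})^b` -/
def onePlusRoot (n : ℕ) (b : ℤ_[p]) : completedField p E :=
  ⟨rootHom p E n (onePlusPow p E b : LaurentSeries E),
    subset_completedField p E (Set.mem_iUnion.2 ⟨n, RingHom.mem_fieldRange_self _ _⟩)⟩

theorem substHom_root (a : ℤ_[p]ˣ) (n : ℕ) :
    substHom p E a (monomial p E n 1 1) = onePlusRoot p E n a - 1 := by
  apply Subtype.ext
  rw [substHom_monomial, zpow_one, map_one, one_mul, gammaSeries]
  change _ = rootHom p E n (onePlusPow p E (a : ℤ_[p]) : LaurentSeries E) - 1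
  rw [PowerSeries.coe_sub, PowerSeries.coe_one, map_sub, map_one]

theorem onePlusRoot_natMul (n k : ℕ) (b : ℤ_[p]) :
    onePlusRoot p E n (k * b) = onePlusRoot p E n b ^ k := by
  apply Subtype.ext
  change rootHom p E n (onePlusPow p E (k * b) : LaurentSeries E) =
    rootHom p E n (onePlusPow p E b : LaurentSeries E) ^ k
  rw [onePlusPow_nsmul, PowerSeries.coe_pow, map_pow]

theorem onePlusRoot_one (n : ℕ) : onePlusRoot p E n 1 = 1 + monomial p E n 1 1 := by
  apply Subtype.ext
  change rootHom p E n (onePlusPow p E 1 : LaurentSeries E) =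
    1 + rootHom p E n (HahnSeries.single 1 1)
  have := onePlusPow_natCast p E 1
  rw [Nat.cast_one, pow_one] at this
  rw [this, PowerSeries.coe_add, PowerSeries.coe_one, PowerSeries.coe_X, map_add, map_one]

theorem onePlusRoot_close (n i : ℕ) (b c : ℤ_[p]) (h : (p : ℤ_[p]) ^ i ∣ b - c) :
    (((p : ℚ) ^ i / (p : ℚ) ^ n : ℚ) : WithTop ℚ) ≤
      ((onePlusRoot p E n b : HahnSeries ℚ E) - onePlusRoot p E n c).orderTop := by
  obtain ⟨d, hd⟩ := h
  obtain ⟨w, hw⟩ : (PowerSeries.X : PowerSeries E) ∣ gammaSeries p E d := by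
    rw [PowerSeries.X_dvd_iff, ← PowerSeries.coeff_zero_eq_constantCoeff_apply]
    exact gammaSeries_coeff_zero p E d
  have hch : CharP (PowerSeries E) p :=
    charP_of_injective_ringHom (PowerSeries.C_injective (R := E)) p
  have h1 : onePlusPow p E b - onePlusPow p E c =
      PowerSeries.X ^ (p ^ i) * (w ^ (p ^ i) * onePlusPow p E c) := by
    have hb : b = ((p ^ i : ℕ) : ℤ_[p]) * d + c := by
      push_cast; rw [← hd]; ring
    rw [hb, onePlusPow_add, onePlusPow_nsmul, ← mul_assoc, ← mul_pow, ← hw, gammaSeries,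
      sub_pow_char_pow, one_pow]
    ring
  have h2 : (onePlusRoot p E n b : HahnSeries ℚ E) - onePlusRoot p E n c =
      rootHom p E n ((PowerSeries.X ^ (p ^ i) * (w ^ (p ^ i) * onePlusPow p E c) : PowerSeries E) :
        LaurentSeries E) := by
    rw [← h1, PowerSeries.coe_sub, map_sub]; rfl
  rw [h2]
  refine HahnSeries.le_orderTop_iff_forall.2 fun q hq => ?_
  by_contra hne
  obtain ⟨j, rfl⟩ := rootHom_coeff_ne p E hne
  rw [rootHom_coeff, PowerSeries.coeff_coe] at hne
  have hq' : ((j : ℚ) / (p : ℚ) ^ n) < (p : ℚ) ^ i / (p : ℚ) ^ n := WithTop.coe_lt_coe.1 hq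
  have h0 : (0 : ℚ) < (p : ℚ) ^ n := by have := hp.out.pos; positivity
  rw [div_lt_div_iff_of_pos_right h0] at hq'
  split_ifs at hne with hj
  · exact hne rfl
  · refine hne ?_
    rw [PowerSeries.coeff_X_pow_mul', if_neg]
    have h3 : j < (p : ℤ) ^ i := by exact_mod_cast hq'
    have h4 : ((p ^ i : ℕ) : ℤ) = (p : ℤ) ^ i := by push_cast; rfl
    omega

theorem substHom_onePlusRoot (a : ℤ_[p]ˣ) (n : ℕ) (b : ℤ_[p]) :
    substHom p E a (onePlusRoot p E n b) = onePlusRoot p E n (a * b) := by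
  have hnat : ∀ k : ℕ, substHom p E a (onePlusRoot p E n k) = onePlusRoot p E n (a * k) := by
    intro k
    have h1 := onePlusRoot_natMul p E n k 1
    rw [mul_one] at h1
    rw [h1, map_pow, onePlusRoot_one, map_add, map_one, substHom_root, mul_comm,
      onePlusRoot_natMul]
    congr 1
    ring
  apply Subtype.ext
  rw [← sub_eq_zero, ← HahnSeries.orderTop_eq_top, ← top_le_iff]
  refine le_of_forall_lt fun c hc => ?_
  lift c to ℚ using hc.ne
  have hp1 : (1 : ℚ) < p := by exact_mod_cast hp.out.one_lt
  have h0 : (0 : ℚ) < (p : ℚ) ^ n := by positivity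
  obtain ⟨i, hi⟩ := pow_unbounded_of_one_lt (c * (p : ℚ) ^ n) hp1
  rw [← lt_div_iff₀ h0] at hi
  refine lt_of_lt_of_le (b := (((p : ℚ) ^ i / (p : ℚ) ^ n : ℚ) : WithTop ℚ))
    (by exact_mod_cast hi) ?_
  obtain ⟨k, hk⟩ : ∃ k : ℕ, (p : ℤ_[p]) ^ i ∣ b - k :=
    ⟨b.appr i, Ideal.mem_span_singleton.1 (PadicInt.appr_spec i b)⟩
  have e : (substHom p E a (onePlusRoot p E n b) : HahnSeries ℚ E) - onePlusRoot p E n (a * b) =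
      (substHom p E a (onePlusRoot p E n b - onePlusRoot p E n k) : HahnSeries ℚ E) -
        ((onePlusRoot p E n (a * b) : HahnSeries ℚ E) - onePlusRoot p E n (a * k)) := by
    rw [map_sub, hnat]
    push_cast
    ring
  rw [e]
  refine (le_min (le_trans ?_ (substHom_le_orderTop p E a _)) ?_).trans
    HahnSeries.min_orderTop_le_orderTop_sub
  · exact onePlusRoot_close p E n i b k hk
  · exact onePlusRoot_close p E n i _ _ (by rw [← mul_sub]; exact hk.mul_left _)

theorem substHom_mul (a b : ℤ_[p]ˣ) :
    substHom p E (a * b) = (substHom p E a).comp (substHom p E b) := by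
  refine substHom_ext p E (substHom_le_orderTop p E _) (fun f => ?_) (fun c => ?_) (fun n => ?_)
  · exact (substHom_le_orderTop p E b f).trans (substHom_le_orderTop p E a _)
  · rw [RingHom.comp_apply, substHom_const, substHom_const, substHom_const]
  · have h1 : substHom p E a (onePlusRoot p E n b - 1) = onePlusRoot p E n (a * b) - 1 := by
      rw [(substHom p E a).map_sub, (substHom p E a).map_one, substHom_onePlusRoot]
    rw [RingHom.comp_apply, substHom_root p E b n, h1, substHom_root p E (a * b) n]
    rfl

theorem substHom_one : substHom p E 1 = RingHom.id _ := by
  refine substHom_ext p E (substHom_le_orderTop p E _) (fun f => le_rfl) (fun c => ?_) (fun n => ?_)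
  · rw [substHom_const, RingHom.id_apply]
  · rw [substHom_root p E 1 n, RingHom.id_apply]
    exact (congrArg (fun x => x - 1) (onePlusRoot_one p E n)).trans (add_sub_cancel_left _ _)

/-- The action of `ℤ_p^×` on `Ẽ` by ring automorphisms, `a • f(X) = f((1 + X)^a - 1)`. -/
instance gammaAction : MulSemiringAction ℤ_[p]ˣ (completedField p E) where
  smul a f := substHom p E a f
  one_smul f := by
    change substHom p E 1 f = f
    rw [substHom_one, RingHom.id_apply]
  mul_smul a b f := by
    change substHom p E (a * b) f = substHom p E a (substHom p E b f)
    rw [substHom_mul, RingHom.comp_apply]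
  smul_zero a := map_zero (substHom p E a)
  smul_add a := map_add (substHom p E a)
  smul_one a := map_one (substHom p E a)
  smul_mul a := map_mul (substHom p E a)

/-- `a • X^{1/p^n} = (1 + X^{1/p^n})^a - 1`. -/
theorem smul_root (a : ℤ_[p]ˣ) (n : ℕ) :
    ((a • monomial p E n 1 1 : completedField p E) : HahnSeries ℚ E) =
      rootHom p E n (gammaSeries p E a : LaurentSeries E) := by
  have h := substHom_monomial p E a n 1 1
  rw [zpow_one, map_one, one_mul] at h
  exact h

/-- The action is trivial on the constants, hence it is `E`-linear. -/
theorem smul_const (a : ℤ_[p]ˣ) (c : E) : a • monomial p E 0 0 c = monomial p E 0 0 c :=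
  substHom_const p E a c

/-- The action is isometric. -/
theorem valX_smul (a : ℤ_[p]ˣ) (f : completedField p E) : valX p E (a • f) = valX p E f := by
  have h1 : (f : HahnSeries ℚ E).orderTop ≤ ((a • f : completedField p E) : HahnSeries ℚ E).orderTop :=
    substHom_le_orderTop p E a f
  have h2 : ((a • f : completedField p E) : HahnSeries ℚ E).orderTop ≤
      ((a⁻¹ • (a • f) : completedField p E) : HahnSeries ℚ E).orderTop :=
    substHom_le_orderTop p E a⁻¹ (a • f)
  rw [inv_smul_smul] at h2
  rw [valX, valX, le_antisymm h2 h1]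

end Action

end SuperHolder

end

/-!
Write `U = X^{1/p^m}` and `T = X^{1/p^n}` with `n ≥ m`.

An element of `E_m = E((U))` satisfies the super-Hölder inequality because `(1 + U)^a - (1 + U)^b`
is divisible by `U^{p^s}` as soon as `p^s` divides `a - b`; this passes to the powers of `U`, and
to their infinite sums (`exists_le_valX_smul_sub_smul`).

For the converse, the `(1 + T)^l` with `0 ≤ l < p^{n-m}` form a basis of `E_n` over `E_m`, and the
projection of `E_n` to the line of `1` extends to `Ẽ` as the normalized trace `tr : Ẽ → E_m`. It
has an explicit description: up to a sign it replaces each `X^q` by `X^{⌊q p^m⌋ / p^m}`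
(`traceCoeff`). The normalized trace is `E_m`-linear (`trace_levelEmb_mul`), lowers valuations by
at most `1`, and commutes with `ℤ_p^×` (`trace_smul`), since `a ∈ ℤ_p^×` maps `(1 + T)^l` to
`(1 + T)^{al}`, which is in `E_m` if and only if `(1 + T)^l` is.

Let `f` be a super-Hölder vector of level `k - m`, let `b = (1 + T)^l` with `l / p^n` not in
`p^{-m} ℤ`, and let `A = tr(b f)`. For `γ = 1 + p^j` with `j` large, `γ b = b w` with
`w = (1 + T)^{p^j l}` in `E_m`, so that `γ A - A = tr(γ b (γ f - f)) + (w - 1) A`. The valuations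
of `γ A - A` and of `tr(γ b (γ f - f))` are at least `p^{j-m} + constant`, but that of `(w - 1) A`
is `p^{j-n} |l|_p^{-1} + constant` if `A ≠ 0`, and `p^{-n} |l|_p^{-1} < p^{-m}`. Hence `A = 0`
(`trace_onePlusRoot_mul_eq_zero`). It follows that `h = f - tr f` satisfies `tr((1 + T)^l h) = 0`
for all `n` and `l`, and the trace form is nondegenerate (`eq_zero_of_trace_mul_eq_zero`), so
`f = tr f` lies in `E_m`.

The set of vectors of level `lam` decreases with `lam`, so every super-Hölder vector is one
of some level `k - m`.
-/

noncomputable section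

namespace SuperHolder

variable (p : ℕ) [hp : Fact p.Prime] (E : Type*) [Field E]

/-! ### The valuation on `Ẽ` -/

variable {p E}

theorem le_valX_iff {c : ℝ} {f : completedField p E} :
    (c : WithTop ℝ) ≤ valX p E f ↔ ∀ q ∈ (f : HahnSeries ℚ E).support, c ≤ q := by
  by_cases hf : (f : HahnSeries ℚ E) = 0
  · simp [valX, hf]
  · rw [valX, ← HahnSeries.order_eq_orderTop_of_ne_zero hf, WithTop.map_coe, WithTop.coe_le_coe]
    constructor
    · intro h q hq
      exact h.trans (by exact_mod_cast HahnSeries.order_le_of_coeff_ne_zero hq)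
    · intro h
      exact h _ (HahnSeries.coeff_order_eq_zero.not.2 hf)

theorem valX_eq_top_iff {f : completedField p E} : valX p E f = ⊤ ↔ f = 0 := by
  rw [valX, WithTop.map_eq_top_iff, HahnSeries.orderTop_eq_top]
  exact ZeroMemClass.coe_eq_zero

theorem valX_mul (f g : completedField p E) :
    valX p E (f * g) = valX p E f + valX p E g := by
  have h : ((f * g : completedField p E) : HahnSeries ℚ E).orderTop =
      (f : HahnSeries ℚ E).orderTop + (g : HahnSeries ℚ E).orderTop := HahnSeries.orderTop_mul _ _
  rw [valX, h]
  exact WithTop.map_add (Rat.castHom ℝ) _ _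

theorem le_valX_mul {c d : ℝ} {f g : completedField p E} (hf : (c : WithTop ℝ) ≤ valX p E f)
    (hg : (d : WithTop ℝ) ≤ valX p E g) : ((c + d : ℝ) : WithTop ℝ) ≤ valX p E (f * g) := by
  rw [valX_mul, WithTop.coe_add]
  exact add_le_add hf hg

theorem le_valX_add {c : ℝ} {f g : completedField p E} (hf : (c : WithTop ℝ) ≤ valX p E f)
    (hg : (c : WithTop ℝ) ≤ valX p E g) : (c : WithTop ℝ) ≤ valX p E (f + g) := by
  rw [le_valX_iff] at *
  intro q hq
  exact (HahnSeries.support_add_subset _ _ hq).elim (hf q) (hg q)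

theorem valX_neg (f : completedField p E) : valX p E (-f) = valX p E f := by
  have h : ((-f : completedField p E) : HahnSeries ℚ E).orderTop =
      (f : HahnSeries ℚ E).orderTop := HahnSeries.orderTop_neg
  rw [valX, h, valX]

theorem le_valX_sub {c : ℝ} {f g : completedField p E} (hf : (c : WithTop ℝ) ≤ valX p E f)
    (hg : (c : WithTop ℝ) ≤ valX p E g) : (c : WithTop ℝ) ≤ valX p E (f - g) := by
  rw [sub_eq_add_neg]
  exact le_valX_add hf (by rwa [valX_neg])

theorem le_valX_of_le {c d : ℝ} {f : completedField p E} (h : (d : WithTop ℝ) ≤ valX p E f)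
    (hcd : c ≤ d) : (c : WithTop ℝ) ≤ valX p E f :=
  le_trans (by exact_mod_cast hcd) h

theorem le_valX_of_le_orderTop {c : ℚ} {f : completedField p E}
    (h : (c : WithTop ℚ) ≤ (f : HahnSeries ℚ E).orderTop) :
    ((c : ℝ) : WithTop ℝ) ≤ valX p E f := by
  refine le_valX_iff.2 fun q hq => ?_
  by_contra hlt
  exact hq (HahnSeries.le_orderTop_iff_forall.1 h q (by exact_mod_cast not_le.1 hlt))

theorem exists_valX_eq {f : completedField p E} (hf : f ≠ 0) :
    ∃ c : ℝ, valX p E f = c :=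
  (WithTop.ne_top_iff_exists.1 (valX_eq_top_iff.not.2 hf)).imp fun _ h => h.symm

theorem exists_le_valX (f : completedField p E) : ∃ c : ℝ, (c : WithTop ℝ) ≤ valX p E f := by
  by_cases hf : f = 0
  · exact ⟨0, by rw [valX_eq_top_iff.2 hf]; exact le_top⟩
  · exact (exists_valX_eq hf).imp fun _ h => h.ge

theorem eq_zero_of_forall_le_valX {f : completedField p E}
    (h : ∀ c : ℝ, (c : WithTop ℝ) ≤ valX p E f) : f = 0 := by
  by_contra hf
  obtain ⟨c, hc⟩ := exists_valX_eq hf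
  have := h (c + 1)
  rw [hc, WithTop.coe_le_coe] at this
  linarith

theorem exists_eq_divPow {f : completedField p E} {q : ℚ}
    (hq : q ∈ (f : HahnSeries ℚ E).support) : ∃ n j, q = divPow p n j :=
  ((mem_completedField_iff p E _).1 f.2).2 q hq

theorem finite_support_inter_Iio (f : completedField p E) (c : ℚ) :
    ((f : HahnSeries ℚ E).support ∩ Set.Iio c).Finite :=
  ((mem_completedField_iff p E _).1 f.2).1 c

variable (p E) in
theorem support_monomial_subset (n : ℕ) (j : ℤ) (c : E) :
    (monomial p E n j c : HahnSeries ℚ E).support ⊆ {divPow p n j} := by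
  rw [monomial_coe]
  exact HahnSeries.support_single_subset

theorem le_valX_monomial (n : ℕ) (j : ℤ) (c : E) :
    (((j : ℝ) / (p : ℝ) ^ n : ℝ) : WithTop ℝ) ≤ valX p E (monomial p E n j c) := by
  rw [le_valX_iff]
  intro q hq
  rw [support_monomial_subset p E n j c hq]
  simp [divPow]

variable (p E) in
theorem valX_monomial (n : ℕ) (j : ℤ) {c : E} (hc : c ≠ 0) :
    valX p E (monomial p E n j c) = (((j : ℝ) / (p : ℝ) ^ n : ℝ) : WithTop ℝ) := by
  rw [valX, monomial_coe, HahnSeries.orderTop_single hc, WithTop.map_coe]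
  simp [divPow]

/-- The principle of extension by continuity: an additive map `Φ` that lowers valuations by a
bounded amount is controlled by its values at the monomials `c X^q`, `q` in the support. -/
theorem le_valX_of_monomial {Φ : completedField p E →+ completedField p E} {C : ℝ}
    (hΦ : ∀ (f : completedField p E) (c : ℝ), (c : WithTop ℝ) ≤ valX p E f →
      ((c - C : ℝ) : WithTop ℝ) ≤ valX p E (Φ f)) {M : ℝ} (f : completedField p E)
    (hf : ∀ n j c, divPow p n j ∈ (f : HahnSeries ℚ E).support →
      (M : WithTop ℝ) ≤ valX p E (Φ (monomial p E n j c))) :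
    (M : WithTop ℝ) ≤ valX p E (Φ f) := by
  have hpoly : ∀ s : Finset ℚ, ∀ g : completedField p E, (g : HahnSeries ℚ E).support ⊆ s →
      (g : HahnSeries ℚ E).support ⊆ (f : HahnSeries ℚ E).support →
      (M : WithTop ℝ) ≤ valX p E (Φ g) := by
    intro s
    induction s using Finset.induction_on with
    | empty =>
      intro g hg _
      have : g = 0 := Subtype.ext
        (HahnSeries.support_eq_empty_iff.1 (Set.subset_empty_iff.1 (by simpa using hg)))
      rw [this, map_zero, valX_eq_top_iff.2 rfl]
      exact le_top
    | insert q s hqs ih =>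
      intro g hg hgf
      by_cases hq : q ∈ (g : HahnSeries ℚ E).support
      · obtain ⟨n, j, rfl⟩ := exists_eq_divPow hq
        set m := monomial p E n j ((g : HahnSeries ℚ E).coeff (divPow p n j)) with hm
        have hsub : ∀ r, r ∈ ((g - m : completedField p E) : HahnSeries ℚ E).support →
            r ∈ (g : HahnSeries ℚ E).support ∧ r ≠ divPow p n j := by
          intro r hr
          have hr' : (g : HahnSeries ℚ E).coeff r - (m : HahnSeries ℚ E).coeff r ≠ 0 := hr
          rw [hm, monomial_coe] at hr'
          by_cases h : r = divPow p n j
          · subst h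
            rw [HahnSeries.coeff_single_same, sub_self] at hr'
            exact absurd rfl hr'
          · rw [HahnSeries.coeff_single_of_ne h, sub_zero] at hr'
            exact ⟨hr', h⟩
        rw [← sub_add_cancel g m, map_add]
        refine le_valX_add (ih _ (fun r hr => ?_) fun r hr => hgf (hsub r hr).1)
          (hf _ _ _ (hgf hq))
        exact (Finset.mem_insert.1 (hg (hsub r hr).1)).resolve_left (hsub r hr).2
      · refine ih g (fun r hr => ?_) hgf
        exact (Finset.mem_insert.1 (hg hr)).resolve_left fun h => hq (h ▸ hr)
  obtain ⟨c, hc⟩ := exists_rat_gt (M + C)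
  -- The valuation of `f - t` is at least `c > M + C`, and `t` is a finite sum of monomials.
  let t : completedField p E := ⟨HahnSeries.truncLT c (f : HahnSeries ℚ E), by
    rw [mem_completedField_iff]
    have hs := HahnSeries.support_truncLT_subset c (f : HahnSeries ℚ E)
    exact ⟨fun d => (finite_support_inter_Iio f d).subset (Set.inter_subset_inter_left _ hs),
      fun q hq => exists_eq_divPow (hs hq)⟩⟩
  have hft : ((c : ℝ) : WithTop ℝ) ≤ valX p E (f - t) := by
    refine le_valX_iff.2 fun q hq => ?_
    by_contra hlt
    refine hq ?_
    change (f : HahnSeries ℚ E).coeff q - (HahnSeries.truncLT c (f : HahnSeries ℚ E)).coeff q = 0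
    rw [HahnSeries.coeff_truncLT_of_lt (by exact_mod_cast not_le.1 hlt), sub_self]
  rw [← sub_add_cancel f t, map_add]
  refine le_valX_add (le_valX_of_le (hΦ _ _ hft) (by linarith))
    (hpoly (finite_support_inter_Iio f c).toFinset t (fun q hq => ?_)
      (HahnSeries.support_truncLT_subset c _))
  rw [Set.Finite.coe_toFinset]
  refine ⟨HahnSeries.support_truncLT_subset c _ hq, ?_⟩
  by_contra h
  refine hq ?_
  change (HahnSeries.truncLT c (f : HahnSeries ℚ E)).coeff q = 0
  rw [HahnSeries.coeff_truncLT]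
  exact if_neg h

theorem eq_zero_of_monomial {Φ : completedField p E →+ completedField p E} {C : ℝ}
    (hΦ : ∀ (f : completedField p E) (c : ℝ), (c : WithTop ℝ) ≤ valX p E f →
      ((c - C : ℝ) : WithTop ℝ) ≤ valX p E (Φ f)) (f : completedField p E)
    (hf : ∀ n j c, divPow p n j ∈ (f : HahnSeries ℚ E).support → Φ (monomial p E n j c) = 0) :
    Φ f = 0 :=
  eq_zero_of_forall_le_valX fun M => le_valX_of_monomial hΦ f fun n j c h => by
    rw [hf n j c h, valX_eq_top_iff.2 rfl]
    exact le_top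

/-! ### The normalized trace `Ẽ → E_m` -/

variable (p E)

/-- The embedding `g(X) ↦ g(X^{1/p^m})` of `E((X))` in `Ẽ`, with image `E_m`. -/
def levelEmb (m : ℕ) : LaurentSeries E →+* completedField p E :=
  (rootHom p E m).codRestrict (completedField p E) fun _ =>
    subset_completedField p E (Set.mem_iUnion.2 ⟨m, RingHom.mem_fieldRange_self _ _⟩)

variable {p E} in
theorem mem_levelField_iff_exists {m : ℕ} {f : completedField p E} :
    (f : HahnSeries ℚ E) ∈ levelField p E m ↔ ∃ g, levelEmb p E m g = f :=
  ⟨fun ⟨g, hg⟩ => ⟨g, Subtype.ext hg⟩, fun ⟨g, hg⟩ => ⟨g, congrArg Subtype.val hg⟩⟩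

theorem levelEmb_single (m : ℕ) (j : ℤ) (c : E) :
    levelEmb p E m (HahnSeries.single j c) = monomial p E m j c := rfl

theorem support_levelEmb {m : ℕ} {g : LaurentSeries E} {q : ℚ}
    (hq : q ∈ (levelEmb p E m g : HahnSeries ℚ E).support) :
    ∃ j, q = divPow p m j ∧ g.coeff j ≠ 0 := by
  have hq' : (rootHom p E m g).coeff q ≠ 0 := hq
  obtain ⟨j, rfl⟩ := rootHom_coeff_ne p E hq'
  exact ⟨j, rfl, by rwa [rootHom_coeff] at hq'⟩

theorem monomial_mul (n : ℕ) (i j : ℤ) (c d : E) :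
    monomial p E n i c * monomial p E n j d = monomial p E n (i + j) (c * d) := by
  rw [← levelEmb_single, ← levelEmb_single, ← map_mul, HahnSeries.single_mul_single,
    levelEmb_single]

theorem monomial_add (n k : ℕ) (j : ℤ) (c : E) :
    monomial p E (n + k) (j * (p : ℤ) ^ k) c = monomial p E n j c := by
  apply Subtype.ext
  rw [monomial_coe, monomial_coe, divPow_mul]

/-- The sign by which the normalized trace weights `X^q`. On `ℤ[1/p]` it is the multiplicative
character with value `-1` at every `1/p^n`, see `sign_divPow`. -/
def sign (q : ℚ) : E := (-1) ^ q.num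

theorem sign_divPow [CharP E p] (n : ℕ) (j : ℤ) : sign E (divPow p n j) = (-1) ^ j := by
  set q := divPow p n j with hq
  have hqd : q = Rat.divInt j ((p : ℤ) ^ n) := by
    rw [hq, Rat.divInt_eq_div]; simp [divPow]
  have hden : q.den ∣ p ^ n := by
    have := Rat.den_dvd j ((p : ℤ) ^ n)
    rw [← hqd] at this
    exact_mod_cast this
  obtain ⟨m, hm, hm'⟩ := (Nat.dvd_prime_pow hp.out).1 hden
  obtain ⟨k, rfl⟩ := Nat.exists_eq_add_of_le hm
  have h1 : q = divPow p m q.num := by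
    conv_lhs => rw [← Rat.num_div_den q]
    simp [divPow, hm']
  have h2 : j = q.num * (p : ℤ) ^ k := by
    apply divPow_injective p (m + k)
    rw [divPow_mul, ← h1]
  -- This includes the case `p = 2`, where `-1 = 1` in `E`.
  have : (-1 : E) ^ ((p : ℤ) ^ k) = -1 := by
    have h := neg_one_pow_expChar_pow E p k
    exact_mod_cast h
  rw [sign, h2, mul_comm, zpow_mul, this]

/-- The coefficient at `X^{N/p^m}` of the normalized trace of level `m` of `f`: the signed sum of
the coefficients of `f` with exponents in `[N/p^m, (N+1)/p^m)`. -/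
def traceCoeff (m : ℕ) (f : completedField p E) (N : ℤ) : E :=
  (-1) ^ N * ∑ᶠ q ∈ {q : ℚ | ⌊q * (p : ℚ) ^ m⌋ = N}, sign E q * (f : HahnSeries ℚ E).coeff q

variable {p E} in
theorem exists_of_traceCoeff_ne_zero {m : ℕ} {f : completedField p E} {N : ℤ}
    (h : traceCoeff p E m f N ≠ 0) :
    ∃ q ∈ (f : HahnSeries ℚ E).support, ⌊q * (p : ℚ) ^ m⌋ = N := by
  obtain ⟨q, hq, hne⟩ := exists_ne_zero_of_finsum_mem_ne_zero (right_ne_zero_of_mul h)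
  exact ⟨q, right_ne_zero_of_mul hne, hq⟩

theorem bddBelow_support_traceCoeff (m : ℕ) (f : completedField p E) :
    BddBelow (Function.support (traceCoeff p E m f)) := by
  refine ⟨⌊(f : HahnSeries ℚ E).order * (p : ℚ) ^ m⌋, fun N hN => ?_⟩
  obtain ⟨q, hq, rfl⟩ := exists_of_traceCoeff_ne_zero hN
  have := HahnSeries.order_le_of_coeff_ne_zero hq
  gcongr

theorem traceCoeff_add (m : ℕ) (f g : completedField p E) (N : ℤ) :
    traceCoeff p E m (f + g) N = traceCoeff p E m f N + traceCoeff p E m g N := by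
  have hfin : ∀ f : completedField p E, ({q : ℚ | ⌊q * (p : ℚ) ^ m⌋ = N} ∩
      Function.support fun q => sign E q * (f : HahnSeries ℚ E).coeff q).Finite := by
    intro f
    refine (finite_support_inter_Iio f ((N + 1) / (p : ℚ) ^ m)).subset ?_
    rintro q ⟨h1, h2⟩
    refine ⟨right_ne_zero_of_mul h2, ?_⟩
    have h0 : (0 : ℚ) < (p : ℚ) ^ m := by have := hp.out.pos; positivity
    rw [Set.mem_Iio, lt_div_iff₀ h0, ← h1]
    exact Int.lt_floor_add_one _
  rw [traceCoeff, traceCoeff, traceCoeff, ← mul_add, ← finsum_mem_add_distrib' (hfin f) (hfin g)]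
  simp_rw [← mul_add]
  rfl

/-- The normalized trace `Ẽ → E((X^{1/p^m}))`, as a Laurent series in `X^{1/p^m}`. It maps the basis
element `(1 + X^{1/p^n})^l` of `E_n` over `E_m` to itself or to `0` according as it belongs to `E_m`
or not, see `trace_onePlusRoot_of_not_dvd`. -/
def laurentTrace (m : ℕ) : completedField p E →+ LaurentSeries E :=
  AddMonoidHom.mk' (fun f => HahnSeries.ofSuppBddBelow (traceCoeff p E m f)
    (bddBelow_support_traceCoeff p E m f)) fun f g => by
      ext N
      simp [traceCoeff_add]

/-- The normalized trace of level `m`, as an endomorphism of `Ẽ` with image `E_m`. -/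
def trace (m : ℕ) : completedField p E →+ completedField p E :=
  (levelEmb p E m).toAddMonoidHom.comp (laurentTrace p E m)

theorem trace_apply (m : ℕ) (f : completedField p E) :
    trace p E m f = levelEmb p E m (laurentTrace p E m f) := rfl

/-- The constant `1` bounds the loss `1 / p^m` for all `m`. -/
theorem le_valX_trace (m : ℕ) {f : completedField p E} {c : ℝ}
    (hf : (c : WithTop ℝ) ≤ valX p E f) :
    ((c - 1 : ℝ) : WithTop ℝ) ≤ valX p E (trace p E m f) := by
  rw [le_valX_iff] at hf ⊢
  intro r hr
  obtain ⟨N, rfl, hN⟩ := support_levelEmb p E hr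
  have hN' : traceCoeff p E m f N ≠ 0 := hN
  obtain ⟨q, hq, rfl⟩ := exists_of_traceCoeff_ne_zero hN'
  have h1 := hf q hq
  have h0 : (1 : ℚ) ≤ (p : ℚ) ^ m := one_le_pow₀ (by exact_mod_cast hp.out.one_lt.le)
  have h2 := Int.lt_floor_add_one (q * (p : ℚ) ^ m)
  have h3 : q - 1 ≤ divPow p m ⌊q * (p : ℚ) ^ m⌋ := by
    change q - 1 ≤ (⌊q * (p : ℚ) ^ m⌋ : ℚ) / (p : ℚ) ^ m
    rw [le_div_iff₀ (by linarith)]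
    linarith
  have h4 : ((q - 1 : ℚ) : ℝ) ≤ (divPow p m ⌊q * (p : ℚ) ^ m⌋ : ℚ) := by exact_mod_cast h3
  push_cast at h4
  linarith

section CharP

variable [CharP E p]

theorem trace_monomial (m n : ℕ) (j : ℤ) (c : E) :
    trace p E m (monomial p E n j c) =
      monomial p E m ⌊divPow p n j * (p : ℚ) ^ m⌋
        ((-1) ^ ⌊divPow p n j * (p : ℚ) ^ m⌋ * ((-1) ^ j * c)) := by
  rw [trace_apply]
  refine congrArg (levelEmb p E m) (a₂ := HahnSeries.single _ _) ?_
  ext N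
  change traceCoeff p E m _ N = _
  by_cases hN : N = ⌊divPow p n j * (p : ℚ) ^ m⌋
  · subst hN
    rw [HahnSeries.coeff_single_same, traceCoeff, monomial_coe]
    congr 1
    rw [finsum_eq_single _ (divPow p n j)]
    · rw [HahnSeries.coeff_single_same, sign_divPow]
      simp
    · intro q hq
      rw [HahnSeries.coeff_single_of_ne hq, mul_zero]
      simp
  · rw [HahnSeries.coeff_single_of_ne hN]
    by_contra hne
    obtain ⟨q, hq, rfl⟩ := exists_of_traceCoeff_ne_zero hne
    rw [support_monomial_subset p E n j c hq] at hN
    exact hN rfl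

end CharP

/-! ### Linearity and equivariance of the normalized trace -/

theorem monomial_zero_one (n : ℕ) : monomial p E n 0 1 = 1 := by
  rw [← levelEmb_single]
  exact map_one _

theorem monomial_one_pow (n l : ℕ) : monomial p E n 1 1 ^ l = monomial p E n l 1 := by
  induction l with
  | zero => simp [monomial_zero_one]
  | succ l ih => rw [pow_succ, ih, monomial_mul, mul_one]; push_cast; rfl

/-- `c X^{j/p^n}` is an element of `E_m` times a nonnegative power of `X^{1/p^(m+n)}`. -/
theorem exists_monomial_eq_mul (m n : ℕ) (j : ℤ) (c : E) :
    ∃ (N : ℤ) (l : ℕ), monomial p E n j c = monomial p E m N c * monomial p E (m + n) l 1 := by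
  have h0 : (p : ℤ) ^ n ≠ 0 := pow_ne_zero _ (by exact_mod_cast hp.out.ne_zero)
  obtain ⟨l, hl⟩ := Int.eq_ofNat_of_zero_le (Int.emod_nonneg (j * (p : ℤ) ^ m) h0)
  refine ⟨j * (p : ℤ) ^ m / (p : ℤ) ^ n, l, ?_⟩
  rw [← monomial_add p E n m, ← monomial_add p E m n, add_comm n m, monomial_mul, mul_one]
  congr 1
  exact (by rw [← hl, mul_comm _ ((p : ℤ) ^ n), Int.mul_ediv_add_emod])

section CharP

variable [CharP E p]

theorem neg_one_zpow_mul_pow (j : ℤ) (k : ℕ) : (-1 : E) ^ (j * (p : ℤ) ^ k) = (-1) ^ j := by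
  rw [← sign_divPow p E k, ← sign_divPow p E 0 j]
  congr 1
  simpa using divPow_mul p 0 k j

theorem trace_monomial_mul_monomial (m n : ℕ) (i j : ℤ) (c d : E) :
    trace p E m (monomial p E m i c * monomial p E n j d) =
      monomial p E m i c * trace p E m (monomial p E n j d) := by
  have h0 : (p : ℚ) ^ m ≠ 0 := pow_ne_zero _ (by exact_mod_cast hp.out.ne_zero)
  have e : monomial p E m i c * monomial p E n j d =
      monomial p E (m + n) (i * (p : ℤ) ^ n + j * (p : ℤ) ^ m) (c * d) := by
    rw [← monomial_mul, monomial_add, add_comm m n, monomial_add]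
  have hfl : ⌊divPow p (m + n) (i * (p : ℤ) ^ n + j * (p : ℤ) ^ m) * (p : ℚ) ^ m⌋ =
      i + ⌊divPow p n j * (p : ℚ) ^ m⌋ := by
    have h1 : divPow p m i * (p : ℚ) ^ m = (i : ℚ) := div_mul_cancel₀ _ h0
    rw [map_add, divPow_mul, add_comm m n, divPow_mul, add_mul, h1, Int.floor_intCast_add]
  rw [e, trace_monomial, trace_monomial, monomial_mul, hfl]
  have hne : (-1 : E) ≠ 0 := neg_ne_zero.2 one_ne_zero
  have h1 : (-1 : E) ^ i * (-1) ^ i = 1 := by rw [← mul_zpow]; simp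
  congr 1
  rw [zpow_add₀ hne, zpow_add₀ hne, neg_one_zpow_mul_pow, neg_one_zpow_mul_pow]
  linear_combination ((-1 : E) ^ ⌊divPow p n j * (p : ℚ) ^ m⌋ * (-1) ^ j * c * d) * h1

/-- The normalized trace is `E_m`-linear. -/
theorem trace_levelEmb_mul (m : ℕ) (g : LaurentSeries E) (f : completedField p E) :
    trace p E m (levelEmb p E m g * f) = levelEmb p E m g * trace p E m f := by
  -- Both sides are additive and continuous in `f` and in `g`, which may be taken to be monomials.
  have hmon : ∀ n j d, trace p E m (levelEmb p E m g * monomial p E n j d) =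
      levelEmb p E m g * trace p E m (monomial p E n j d) := by
    intro n j d
    set b := monomial p E n j d with hb
    obtain ⟨u, hu⟩ := exists_le_valX b
    obtain ⟨v, hv⟩ := exists_le_valX (trace p E m b)
    refine sub_eq_zero.1 (eq_zero_of_monomial (C := max (1 - u) (-v))
      (Φ := (trace p E m).comp (AddMonoidHom.mulRight b) -
        AddMonoidHom.mulRight (trace p E m b)) (fun f c hf => ?_) (levelEmb p E m g)
        fun n' j' c h => ?_)
    · refine le_valX_sub (le_valX_of_le (le_valX_trace p E m (le_valX_mul hf hu)) ?_)
        (le_valX_of_le (le_valX_mul hf hv) ?_)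
      · linarith [le_max_left (1 - u) (-v)]
      · linarith [le_max_right (1 - u) (-v)]
    · obtain ⟨i, hi, -⟩ := support_levelEmb p E h
      have : monomial p E n' j' c = monomial p E m i c := by
        apply Subtype.ext
        rw [monomial_coe, monomial_coe, hi]
      rw [this]
      exact sub_eq_zero.2 (trace_monomial_mul_monomial p E m n i j c d)
  obtain ⟨u, hu⟩ := exists_le_valX (levelEmb p E m g)
  refine sub_eq_zero.1 (eq_zero_of_monomial (C := 1 - u)
    (Φ := (trace p E m).comp (AddMonoidHom.mulLeft (levelEmb p E m g)) -
      (AddMonoidHom.mulLeft (levelEmb p E m g)).comp (trace p E m)) (fun f c hf => ?_) f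
      fun n j c _ => sub_eq_zero.2 (hmon n j c))
  exact le_valX_sub (le_valX_of_le (le_valX_trace p E m (le_valX_mul hu hf)) (by linarith))
    (le_valX_of_le (le_valX_mul hu (le_valX_trace p E m hf)) (by linarith))

theorem trace_one (m : ℕ) : trace p E m 1 = 1 := by
  rw [← monomial_zero_one p E m, trace_monomial]
  simp

theorem trace_levelEmb (m : ℕ) (g : LaurentSeries E) :
    trace p E m (levelEmb p E m g) = levelEmb p E m g := by
  have := trace_levelEmb_mul p E m g 1
  rwa [trace_one, mul_one] at this

theorem levelEmb_onePlusPow (n : ℕ) (b : ℤ_[p]) :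
    levelEmb p E n (onePlusPow p E b : LaurentSeries E) = onePlusRoot p E n b := rfl

theorem onePlusRoot_add (n : ℕ) (b c : ℤ_[p]) :
    onePlusRoot p E n (b + c) = onePlusRoot p E n b * onePlusRoot p E n c := by
  rw [← levelEmb_onePlusPow, onePlusPow_add, PowerSeries.coe_mul, map_mul]
  rfl

theorem onePlusRoot_pow_mul (n s : ℕ) (b : ℤ_[p]) :
    onePlusRoot p E (n + s) ((p : ℤ_[p]) ^ s * b) = onePlusRoot p E n b := by
  have hch : CharP (PowerSeries E) p :=
    charP_of_injective_ringHom (PowerSeries.C_injective (R := E)) p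
  have hsucc : ∀ n b, onePlusRoot p E (n + 1) ((p : ℤ_[p]) * b) = onePlusRoot p E n b := by
    intro n b
    have h1 : onePlusPow p E (p * b) = PowerSeries.expand p hp.out.ne_zero (onePlusPow p E b) := by
      have h2 : onePlusPow p E b = gammaSeries p E b + 1 := (sub_add_cancel _ _).symm
      rw [onePlusPow_nsmul, h2, add_pow_char, one_pow, gammaSeries_pow, map_add, map_one]
    apply Subtype.ext
    change rootHom p E (n + 1) (onePlusPow p E (p * b) : LaurentSeries E) =
      rootHom p E n (onePlusPow p E b : LaurentSeries E)
    rw [h1, rootHom_succ]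
  induction s with
  | zero => simp
  | succ s ih => rw [pow_succ', mul_assoc, ← add_assoc, hsucc, ih]

theorem trace_root_pow (m s r : ℕ) (hr : r < p ^ s) :
    trace p E m (monomial p E (m + s) 1 1 ^ r) = (-1) ^ r := by
  have h0 : (0 : ℚ) < p := by exact_mod_cast hp.out.pos
  have hfl : ⌊divPow p (m + s) r * (p : ℚ) ^ m⌋ = 0 := by
    rw [Int.floor_eq_zero_iff]
    change ((r : ℤ) : ℚ) / (p : ℚ) ^ (m + s) * (p : ℚ) ^ m ∈ Set.Ico 0 1
    have : ((r : ℤ) : ℚ) / (p : ℚ) ^ (m + s) * (p : ℚ) ^ m = r / (p : ℚ) ^ s := by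
      rw [pow_add]; push_cast; field_simp
    rw [this]
    refine ⟨by positivity, (div_lt_one (by positivity)).2 (by exact_mod_cast hr)⟩
  rw [monomial_one_pow, trace_monomial, hfl, zpow_zero, one_mul, mul_one, zpow_natCast,
    ← levelEmb_single]
  change levelEmb p E m (HahnSeries.C ((-1) ^ r)) = _
  rw [map_pow, map_neg, map_one, map_pow, map_neg, map_one]

/-- For `r < p^s` the trace of `(X^{1/p^(m+s)})^r` is `(-1)^r`, so the trace of
`(1 + X^{1/p^(m+s)})^t` is `(1 + (-1))^t` by the binomial theorem. -/
theorem trace_onePlusRoot_natCast (m s t : ℕ) (h0 : t ≠ 0) (ht : t < p ^ s) :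
    trace p E m (onePlusRoot p E (m + s) t) = 0 := by
  have h1 := onePlusRoot_natMul p E (m + s) t 1
  rw [mul_one, onePlusRoot_one, add_comm (1 : completedField p E), add_pow] at h1
  have h2 : (∑ r ∈ Finset.range (t + 1), (-1 : completedField p E) ^ r * 1 ^ (t - r) *
      (t.choose r : completedField p E)) = 0 := by
    rw [← add_pow, neg_add_cancel, zero_pow h0]
  rw [h1, map_sum, ← h2]
  refine Finset.sum_congr rfl fun r hr => ?_
  rw [one_pow, mul_one, mul_one, mul_comm, ← nsmul_eq_mul, map_nsmul, trace_root_pow, nsmul_eq_mul,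
    mul_comm]
  exact lt_of_le_of_lt (Finset.mem_range_succ_iff.1 hr) ht

theorem trace_onePlusRoot_of_not_dvd (m s : ℕ) (b : ℤ_[p]) (hb : ¬ (p : ℤ_[p]) ^ s ∣ b) :
    trace p E m (onePlusRoot p E (m + s) b) = 0 := by
  obtain ⟨b', hb'⟩ : (p : ℤ_[p]) ^ s ∣ b - b.appr s :=
    Ideal.mem_span_singleton.1 (PadicInt.appr_spec s b)
  have h1 : b = (p : ℤ_[p]) ^ s * b' + b.appr s := by rw [← hb', sub_add_cancel]
  have h0 : b.appr s ≠ 0 := by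
    intro h
    rw [h, Nat.cast_zero, add_zero] at h1
    exact hb ⟨b', h1⟩
  rw [h1, onePlusRoot_add, onePlusRoot_pow_mul, ← levelEmb_onePlusPow p E m, trace_levelEmb_mul,
    trace_onePlusRoot_natCast p E m s _ h0 (PadicInt.appr_lt b s), mul_zero]

theorem trace_onePlusRoot (m : ℕ) (b : ℤ_[p]) :
    trace p E m (onePlusRoot p E m b) = onePlusRoot p E m b :=
  trace_levelEmb p E m _

/-- The polynomials in `X^{1/p^n}` are spanned by the powers of `1 + X^{1/p^n}`. -/
theorem map_monomial_eq_zero_of_onePlusRoot {Φ : completedField p E →+ completedField p E} (n : ℕ)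
    (h : ∀ r : ℕ, Φ (onePlusRoot p E n r) = 0) (l : ℕ) : Φ (monomial p E n l 1) = 0 := by
  have key : ∀ l r : ℕ, Φ (monomial p E n 1 1 ^ l * onePlusRoot p E n r) = 0 := by
    intro l
    induction l with
    | zero => intro r; rw [pow_zero, one_mul, h]
    | succ l ih =>
      intro r
      have e : monomial p E n 1 1 ^ (l + 1) * onePlusRoot p E n r =
          monomial p E n 1 1 ^ l * onePlusRoot p E n (r + 1 : ℕ) -
            monomial p E n 1 1 ^ l * onePlusRoot p E n r := by
        rw [Nat.cast_succ, onePlusRoot_add, onePlusRoot_one]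
        ring
      rw [e, map_sub, ih, ih, sub_zero]
  have h1 := key l 0
  have h2 := onePlusRoot_natMul p E n 0 1
  rw [Nat.cast_zero, zero_mul, pow_zero] at h2
  rwa [Nat.cast_zero, h2, mul_one, monomial_one_pow] at h1

theorem smul_monomial (a : ℤ_[p]ˣ) (n : ℕ) (j : ℤ) (c : E) :
    a • monomial p E n j c = levelEmb p E n
      (HahnSeries.C c * (gammaSeries p E a : LaurentSeries E) ^ j) := by
  apply Subtype.ext
  refine (substHom_monomial p E a n j c).trans ?_
  change _ = rootHom p E n _
  rw [map_mul]
  congr 1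
  change HahnSeries.single 0 c = rootHom p E n (HahnSeries.single 0 c)
  rw [rootHom_single, map_zero]

theorem smul_onePlusRoot (a : ℤ_[p]ˣ) (n : ℕ) (b : ℤ_[p]) :
    a • onePlusRoot p E n b = onePlusRoot p E n (a * b) :=
  substHom_onePlusRoot p E a n b

/-- The normalized trace commutes with the action of `ℤ_p^×`, because this action permutes the
`(1 + X^{1/p^n})^b` and preserves the valuation of `b`. -/
theorem trace_smul (m : ℕ) (a : ℤ_[p]ˣ) (f : completedField p E) :
    trace p E m (a • f) = a • trace p E m f := by
  set Φ : completedField p E →+ completedField p E :=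
    (trace p E m).comp (DistribSMul.toAddMonoidHom _ a) -
      (DistribSMul.toAddMonoidHom _ a).comp (trace p E m) with hΦ
  have hΦ' : ∀ f, Φ f = trace p E m (a • f) - a • trace p E m f := fun _ => rfl
  have hone : ∀ s r : ℕ, Φ (onePlusRoot p E (m + s) r) = 0 := by
    intro s r
    rw [hΦ', smul_onePlusRoot]
    by_cases hr : (p : ℤ_[p]) ^ s ∣ r
    · obtain ⟨b, hb⟩ := hr
      rw [hb, mul_left_comm, onePlusRoot_pow_mul, onePlusRoot_pow_mul, trace_onePlusRoot,
        trace_onePlusRoot, smul_onePlusRoot, sub_self]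
    · rw [trace_onePlusRoot_of_not_dvd p E m s r hr, smul_zero, sub_zero]
      refine trace_onePlusRoot_of_not_dvd p E m s _ fun h => hr ?_
      exact (Units.dvd_mul_left).1 h
  refine sub_eq_zero.1 (eq_zero_of_monomial (C := 1) (Φ := Φ) (fun f c hf => ?_) f
    fun n j c _ => ?_)
  · refine le_valX_sub (f := trace p E m (a • f)) (g := a • trace p E m f)
      (le_valX_trace p E m (by rwa [valX_smul])) ?_
    rw [valX_smul]
    exact le_valX_trace p E m hf
  · obtain ⟨N, l, h⟩ := exists_monomial_eq_mul p E m n j c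
    have h1 := map_monomial_eq_zero_of_onePlusRoot p E (m + n) (hone n) l
    rw [hΦ', sub_eq_zero] at h1 ⊢
    rw [h, smul_mul', smul_monomial, trace_levelEmb_mul, h1, ← levelEmb_single p E m,
      trace_levelEmb_mul, smul_mul', levelEmb_single, smul_monomial]

/-! ### The elements of `E_m` are super-Hölder vectors -/

theorem smul_root_eq (a : ℤ_[p]ˣ) (n : ℕ) :
    a • monomial p E n 1 1 = onePlusRoot p E n a - 1 :=
  substHom_root p E a n

theorem le_valX_smul_sub_smul_root_pow (m s : ℕ) {a b : ℤ_[p]ˣ}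
    (h : (p : ℤ_[p]) ^ s ∣ (a : ℤ_[p]) - b) (l : ℕ) :
    ((((l : ℝ) - 1 + (p : ℝ) ^ s) / (p : ℝ) ^ m : ℝ) : WithTop ℝ) ≤
      valX p E (a • monomial p E m l 1 - b • monomial p E m l 1) := by
  induction l with
  | zero => simp [monomial_zero_one, valX_eq_top_iff.2]
  | succ l ih =>
    have e : a • monomial p E m (l + 1 : ℕ) 1 - b • monomial p E m (l + 1 : ℕ) 1 =
        a • monomial p E m 1 1 * (a • monomial p E m l 1 - b • monomial p E m l 1) +
          (a • monomial p E m 1 1 - b • monomial p E m 1 1) * b • monomial p E m l 1 := by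
      have h1 : monomial p E m (l + 1 : ℕ) 1 = monomial p E m 1 1 * monomial p E m l 1 := by
        rw [monomial_mul, mul_one, add_comm]
        push_cast
        rfl
      rw [h1, smul_mul', smul_mul']
      ring
    have h1 : (((p : ℝ) ^ s / (p : ℝ) ^ m : ℝ) : WithTop ℝ) ≤
        valX p E (a • monomial p E m 1 1 - b • monomial p E m 1 1) := by
      rw [smul_root_eq, smul_root_eq, sub_sub_sub_cancel_right]
      have := le_valX_of_le_orderTop (f := onePlusRoot p E m a - onePlusRoot p E m b)
        (onePlusRoot_close p E m s a b h)
      exact le_valX_of_le this (by push_cast; rfl)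
    have h2 : ∀ (c : ℤ_[p]ˣ) (j : ℤ), (((j : ℝ) / (p : ℝ) ^ m : ℝ) : WithTop ℝ) ≤
        valX p E (c • monomial p E m j 1) := fun c j => by
      rw [valX_smul]; exact le_valX_monomial m j 1
    rw [e]
    refine le_valX_add (le_valX_of_le (le_valX_mul (h2 a 1) ih) (le_of_eq ?_))
      (le_valX_of_le (le_valX_mul h1 (h2 b l)) (le_of_eq ?_)) <;>
    · push_cast; ring

theorem le_valX_smul_sub_smul_monomial (m s : ℕ) {a b : ℤ_[p]ˣ}
    (h : (p : ℤ_[p]) ^ s ∣ (a : ℤ_[p]) - b) (j : ℤ) (c : E) :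
    ((((j : ℝ) - 1 + (p : ℝ) ^ s) / (p : ℝ) ^ m : ℝ) : WithTop ℝ) ≤
      valX p E (a • monomial p E m j c - b • monomial p E m j c) := by
  have h2 : ∀ (c : ℤ_[p]ˣ) (j : ℤ), (((j : ℝ) / (p : ℝ) ^ m : ℝ) : WithTop ℝ) ≤
      valX p E (c • monomial p E m j 1) := fun c j => by
    rw [valX_smul]; exact le_valX_monomial m j 1
  have h1 : ((((j : ℝ) - 1 + (p : ℝ) ^ s) / (p : ℝ) ^ m : ℝ) : WithTop ℝ) ≤
      valX p E (a • monomial p E m j 1 - b • monomial p E m j 1) := by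
    obtain ⟨l, rfl | rfl⟩ := j.eq_nat_or_neg
    · exact_mod_cast le_valX_smul_sub_smul_root_pow p E m s h l
    -- With `A = a • X^{1/p^m}` and `B = b • X^{1/p^m}`:
    -- `A^(-l) - B^(-l) = -A^(-l) B^(-l) (A^l - B^l)`.
    · have hinv : ∀ u : ℤ_[p]ˣ, u • monomial p E m (-(l : ℤ)) 1 * u • monomial p E m l 1 = 1 := by
        intro u
        rw [← smul_mul', monomial_mul, neg_add_cancel, mul_one, monomial_zero_one, smul_one]
      have e : a • monomial p E m (-(l : ℤ)) 1 - b • monomial p E m (-(l : ℤ)) 1 =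
          -(a • monomial p E m (-(l : ℤ)) 1 * b • monomial p E m (-(l : ℤ)) 1 *
            (a • monomial p E m l 1 - b • monomial p E m l 1)) := by
        linear_combination (b • monomial p E m (-(l : ℤ)) 1) * hinv a -
          (a • monomial p E m (-(l : ℤ)) 1) * hinv b
      rw [e, valX_neg]
      refine le_valX_of_le (le_valX_mul (le_valX_mul (h2 a _) (h2 b _))
        (le_valX_smul_sub_smul_root_pow p E m s h l)) (le_of_eq ?_)
      push_cast
      ring
  have hc : ∀ u : ℤ_[p]ˣ, u • monomial p E m j c = monomial p E 0 0 c * u • monomial p E m j 1 := by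
    intro u
    have : monomial p E m j c = monomial p E 0 0 c * monomial p E m j 1 := by
      rw [← monomial_add p E 0 m, zero_mul, zero_add, monomial_mul, zero_add, mul_one]
    rw [this, smul_mul', smul_const]
  rw [hc, hc, ← mul_sub]
  exact le_valX_of_le (le_valX_mul (le_valX_monomial 0 0 c) h1) (by simp)

/-- The orbit map of an element of `E_m` satisfies the super-Hölder inequality of level `-m` on
`ℤ_p^×`, hence that of level `k - m` on `Γ_k`. -/
theorem exists_le_valX_smul_sub_smul (m : ℕ) (g : LaurentSeries E) :
    ∃ mu : ℝ, ∀ (s : ℕ) (a b : ℤ_[p]ˣ), (p : ℤ_[p]) ^ s ∣ (a : ℤ_[p]) - b →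
      (((p : ℝ) ^ s / (p : ℝ) ^ m + mu : ℝ) : WithTop ℝ) ≤
        valX p E (a • levelEmb p E m g - b • levelEmb p E m g) := by
  obtain ⟨v, hv⟩ := exists_le_valX (levelEmb p E m g)
  refine ⟨v - 1, fun s a b h => ?_⟩
  refine le_valX_of_monomial (C := 0) (Φ := DistribSMul.toAddMonoidHom _ a -
    DistribSMul.toAddMonoidHom _ b) (fun f c hf => ?_) (levelEmb p E m g) fun n j c hj => ?_
  · rw [sub_zero]
    exact le_valX_sub (f := a • f) (g := b • f) (by rwa [valX_smul]) (by rwa [valX_smul])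
  · obtain ⟨i, hi, -⟩ := support_levelEmb p E hj
    have e : monomial p E n j c = monomial p E m i c := by
      apply Subtype.ext
      rw [monomial_coe, monomial_coe, hi]
    rw [e]
    have h1 := le_valX_iff.1 hv _ hj
    have h2 : ((divPow p n j : ℚ) : ℝ) = (i : ℝ) / (p : ℝ) ^ m := by
      rw [hi]; simp [divPow]
    have h0 : 1 / (p : ℝ) ^ m ≤ 1 := div_le_one_of_le₀
      (one_le_pow₀ (by exact_mod_cast hp.out.one_lt.le)) (by positivity)
    refine le_valX_of_le (le_valX_smul_sub_smul_monomial p E m s h i c) ?_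
    rw [add_div, sub_div]
    linarith

/-! ### The normalized trace of a super-Hölder vector -/

theorem valX_onePlusRoot_sub_one (m r : ℕ) (u : ℤ_[p]ˣ) :
    valX p E (onePlusRoot p E m ((p : ℤ_[p]) ^ r * u) - 1) =
      (((p : ℝ) ^ r / (p : ℝ) ^ m : ℝ) : WithTop ℝ) := by
  -- The left side is `(u • X^{1/p^m})^(p^r)`, by the Frobenius.
  have hch : CharP (completedField p E) p := charP_of_injective_ringHom
    ((levelEmb p E 0).comp HahnSeries.C).injective p
  have e : onePlusRoot p E m ((p : ℤ_[p]) ^ r * u) - 1 = u • monomial p E m (p ^ r : ℕ) 1 := by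
    have h1 := onePlusRoot_natMul p E m (p ^ r) u
    rw [Nat.cast_pow] at h1
    rw [h1, ← monomial_one_pow, smul_pow', smul_root_eq, sub_pow_char_pow, one_pow]
  rw [e, valX_smul, valX_monomial p E m _ one_ne_zero]
  push_cast
  rfl

theorem zero_le_valX_onePlusRoot (n : ℕ) (b : ℤ_[p]) :
    ((0 : ℝ) : WithTop ℝ) ≤ valX p E (onePlusRoot p E n b) := by
  refine le_valX_iff.2 fun q hq => ?_
  obtain ⟨j, rfl, hj⟩ := support_levelEmb p E (g := (onePlusPow p E b : LaurentSeries E)) hq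
  rw [PowerSeries.coeff_coe] at hj
  have hj0 : 0 ≤ j := by
    by_contra h
    exact hj (if_pos (not_le.1 h))
  have : (0 : ℚ) ≤ divPow p n j := div_nonneg (by exact_mod_cast hj0) (by positivity)
  exact_mod_cast this

/-- If `γ f - f` is as small as for an element of `E_m` when `γ = 1 + p^j` tends to `1`, then the
component of `f` along `(1 + X^{1/p^n})^{-l}` vanishes when `l / p^n` is not in `p^{-m} ℤ`: here
`A = tr(b f)` with `b = (1 + X^{1/p^n})^l` is that component, and
`γ A - A = tr(γ b (γ f - f)) + (w - 1) A` with `γ b = b w`, where `w - 1` has a smaller valuation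
than is allowed by the other two terms. -/
theorem trace_onePlusRoot_mul_eq_zero (m s l k : ℕ) (hl : ¬ (p : ℤ_[p]) ^ s ∣ l)
    {f : completedField p E} {mu : ℝ}
    (hf : ∀ (j : ℕ) (γ : ℤ_[p]ˣ), k ≤ j → (γ : ℤ_[p]) = 1 + (p : ℤ_[p]) ^ j →
      (((p : ℝ) ^ j / (p : ℝ) ^ m + mu : ℝ) : WithTop ℝ) ≤ valX p E (γ • f - f)) :
    trace p E m (onePlusRoot p E (m + s) l * f) = 0 := by
  have hl0 : l ≠ 0 := by rintro rfl; exact hl (by simp)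
  obtain ⟨v, l', hl', hlv⟩ := Nat.exists_eq_pow_mul_and_not_dvd hl0 p hp.out.ne_one
  have hvs : v + 1 ≤ s := by
    by_contra h
    refine hl ?_
    rw [hlv]
    push_cast
    exact (pow_dvd_pow _ (by omega)).mul_right _
  obtain ⟨u, hu⟩ : IsUnit (l' : ℤ_[p]) := by
    rw [PadicInt.isUnit_iff, PadicInt.norm_natCast_eq_one_iff]
    exact (Nat.Prime.coprime_iff_not_dvd hp.out).2 hl'
  set b := onePlusRoot p E (m + s) l with hb
  set A := trace p E m (b * f) with hA
  by_contra hA0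
  obtain ⟨α, hα⟩ := exists_valX_eq hA0
  obtain ⟨muA, hmuA⟩ := exists_le_valX_smul_sub_smul p E m (laurentTrace p E m (b * f))
  have hp1 : (1 : ℝ) < p := by exact_mod_cast hp.out.one_lt
  have hpm : (0 : ℝ) < (p : ℝ) ^ m := by positivity
  set C := min muA (mu - 1) with hC
  obtain ⟨t', ht'⟩ := pow_unbounded_of_one_lt ((α - C) * (p : ℝ) ^ m) hp1
  -- For `γ = 1 + p^(s + t)`, the valuation of `w - 1` is `p^(t + v) / p^m`, and `v < s`.
  set t := max t' (k + 1) with ht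
  obtain ⟨γ, hγ⟩ := isUnit_one_add p (k := s + t) (by omega) 1
  rw [mul_one] at hγ
  set w := onePlusRoot p E m ((p : ℤ_[p]) ^ t * l) with hw
  have hγb : γ • b = w * b := by
    rw [hb, smul_onePlusRoot, hγ, add_mul, one_mul, onePlusRoot_add, pow_add, mul_assoc,
      onePlusRoot_pow_mul, mul_comm]
  have e : (w - 1) * A = (γ • A - A) - trace p E m (γ • b * (γ • f - f)) := by
    have h1 : γ • A = trace p E m (γ • b * (γ • f - f)) + w * A := by
      rw [hA, ← trace_smul, hw, ← levelEmb_onePlusPow, ← trace_levelEmb_mul, levelEmb_onePlusPow,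
        ← hw, ← map_add, smul_mul', ← mul_assoc, ← hγb, mul_sub, sub_add_cancel]
    rw [h1]
    ring
  have h1 : (((p : ℝ) ^ (s + t) / (p : ℝ) ^ m + C : ℝ) : WithTop ℝ) ≤ valX p E ((w - 1) * A) := by
    rw [e]
    refine le_valX_sub (le_valX_of_le (?_ : ((_ : ℝ) : WithTop ℝ) ≤ _)
      (add_le_add_right (min_le_left _ _) _))
      (le_valX_of_le (le_valX_trace p E m (le_valX_mul (c := 0) ?_
        (hf (s + t) γ (by omega) hγ))) ?_)
    · have := hmuA (s + t) γ 1 (by rw [hγ]; simp)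
      rwa [one_smul, ← trace_apply] at this
    · rw [valX_smul]
      exact zero_le_valX_onePlusRoot p E _ _
    · linarith [min_le_right muA (mu - 1)]
  have h2 : valX p E (w - 1) = (((p : ℝ) ^ (t + v) / (p : ℝ) ^ m : ℝ) : WithTop ℝ) := by
    rw [← valX_onePlusRoot_sub_one p E m (t + v) u, hw, hu, hlv]
    congr 3
    push_cast
    ring
  rw [valX_mul, h2, hα, ← WithTop.coe_add, WithTop.coe_le_coe] at h1
  have h3 : 2 * (p : ℝ) ^ (t + v) ≤ (p : ℝ) ^ (s + t) := by
    calc 2 * (p : ℝ) ^ (t + v) ≤ p * (p : ℝ) ^ (t + v) := by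
          gcongr
          exact_mod_cast hp.out.two_le
      _ = (p : ℝ) ^ (t + v + 1) := by ring
      _ ≤ (p : ℝ) ^ (s + t) := pow_le_pow_right₀ hp1.le (by omega)
  have h4 : (p : ℝ) ^ t' ≤ (p : ℝ) ^ (t + v) := pow_le_pow_right₀ hp1.le (by omega)
  have h5 : (p : ℝ) ^ (t + v) / (p : ℝ) ^ m ≤ α - C := by
    have : 2 * (p : ℝ) ^ (t + v) / (p : ℝ) ^ m ≤ (p : ℝ) ^ (s + t) / (p : ℝ) ^ m := by gcongr
    rw [mul_div_assoc] at this
    linarith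
  rw [div_le_iff₀ hpm] at h5
  linarith

/-- The trace form is nondegenerate: an `h ≠ 0` has a multiple `X^e h` whose leading exponent lies
so close below `1/p^m` that it is the only exponent in `[0, 1/p^m)`. -/
theorem eq_zero_of_trace_mul_eq_zero (m : ℕ) {h : completedField p E}
    (hh : ∀ s l : ℕ, trace p E m (onePlusRoot p E (m + s) l * h) = 0) : h = 0 := by
  have hmon : ∀ n j, trace p E m (monomial p E n j 1 * h) = 0 := by
    intro n j
    obtain ⟨N, l, e⟩ := exists_monomial_eq_mul p E m n j 1
    have h1 := map_monomial_eq_zero_of_onePlusRoot p E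
      (Φ := (trace p E m).comp (AddMonoidHom.mulRight h)) (m + n) (hh n) l
    have h2 : trace p E m (monomial p E (m + n) l 1 * h) = 0 := h1
    rw [e, mul_assoc, ← levelEmb_single p E m, trace_levelEmb_mul, h2, mul_zero]
  by_contra hne
  have hne' : (h : HahnSeries ℚ E) ≠ 0 := fun h0 => hne (Subtype.ext h0)
  set q₀ := (h : HahnSeries ℚ E).order with hq₀
  have hc : (h : HahnSeries ℚ E).coeff q₀ ≠ 0 := HahnSeries.coeff_order_eq_zero.not.2 hne'
  have hp1 : (1 : ℚ) < p := by exact_mod_cast hp.out.one_lt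
  obtain ⟨r, hr, hrm⟩ : ∃ r : ℕ, (∀ q ∈ (h : HahnSeries ℚ E).support ∩ Set.Iio (q₀ + 1), q ≠ q₀ →
      (1 / (p : ℚ)) ^ r < q - q₀) ∧ m ≤ r := by
    refine Filter.Eventually.exists (f := Filter.atTop) (Filter.Eventually.and ?_
      (Filter.eventually_ge_atTop m))
    rw [Filter.eventually_all_finite (finite_support_inter_Iio h _)]
    intro q hq
    by_cases hqq : q = q₀
    · simp [hqq]
    · have h1 : q₀ ≤ q := HahnSeries.order_le_of_coeff_ne_zero hq.1
      have h2 : q₀ < q := lt_of_le_of_ne h1 (Ne.symm hqq)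
      have h3 := tendsto_pow_atTop_nhds_zero_of_lt_one (r := 1 / (p : ℚ)) (by positivity)
        ((div_lt_one (by linarith)).2 hp1)
      filter_upwards [h3.eventually_lt_const (sub_pos.2 h2)] with r hr _ using hr
  -- In `X^(d - δ - q₀) h` the exponent `q₀` becomes `d - δ`, which lies in `[0, d)`, and every
  -- other exponent becomes at least `d`. So the coefficient of the trace at `X^0` is `± h_{q₀}`.
  set d := (1 / (p : ℚ)) ^ m with hd
  set δ := (1 / (p : ℚ)) ^ r with hδ
  have hdiv : ∀ n, (1 / (p : ℚ)) ^ n = divPow p n 1 := fun n => by simp [divPow]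
  have hdm : d * (p : ℚ) ^ m = 1 := by
    rw [hd, one_div, inv_pow, inv_mul_cancel₀ (by positivity)]
  have hδd : δ ≤ d := pow_le_pow_of_le_one (by positivity)
    ((div_lt_one (by linarith)).2 hp1).le hrm
  have hδ0 : 0 < δ := by positivity
  have hpm : (0 : ℚ) < (p : ℚ) ^ m := by positivity
  obtain ⟨n, j, hnj⟩ : ∃ n j, d - δ - q₀ = divPow p n j := by
    obtain ⟨n₁, i₁, j₁, h1, h2⟩ := exists_divPow_add p ⟨m, 1, hdiv m⟩ ⟨r, 1, hdiv r⟩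
    obtain ⟨n₂, i₂, j₂, h3, h4⟩ := exists_divPow_add p ⟨n₁, i₁ - j₁, rfl⟩
      (exists_eq_divPow (f := h) hc)
    exact ⟨n₂, i₂ - j₂, by rw [map_sub, ← h3, ← h4, map_sub, ← h1, ← h2]⟩
  have hcoeff : ∀ q, ((monomial p E n j 1 * h : completedField p E) : HahnSeries ℚ E).coeff q =
      (h : HahnSeries ℚ E).coeff (q - (d - δ - q₀)) := by
    intro q
    change ((monomial p E n j 1 : HahnSeries ℚ E) * (h : HahnSeries ℚ E)).coeff q = _
    rw [monomial_coe, HahnSeries.coeff_single_mul, one_mul, hnj]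
  have h0 : laurentTrace p E m (monomial p E n j 1 * h) = 0 :=
    (levelEmb p E m).injective ((hmon n j).trans (map_zero _).symm)
  have h1 : traceCoeff p E m (monomial p E n j 1 * h) 0 = 0 :=
    congrArg (fun g : LaurentSeries E => g.coeff 0) h0
  rw [traceCoeff, zpow_zero, one_mul, finsum_eq_single _ (d - δ)] at h1
  · have hfl : d - δ ∈ {q : ℚ | ⌊q * (p : ℚ) ^ m⌋ = 0} := by
      rw [Set.mem_ofPred_eq, Int.floor_eq_zero_iff, sub_mul, hdm]
      constructor
      · have := mul_le_mul_of_nonneg_right hδd hpm.le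
        linarith
      · have := mul_pos hδ0 hpm
        linarith
    rw [finsum_eq_if, if_pos hfl, hcoeff, sub_sub_cancel] at h1
    exact (mul_ne_zero (zpow_ne_zero _ (neg_ne_zero.2 one_ne_zero)) hc) h1
  · intro q hq
    rw [finsum_eq_if]
    split_ifs with hfl
    · rw [Set.mem_ofPred_eq] at hfl
      rw [hcoeff]
      by_contra hne2
      have hsupp := right_ne_zero_of_mul hne2
      have h2 : q * (p : ℚ) ^ m < d * (p : ℚ) ^ m := by
        rw [hdm]
        have := Int.lt_floor_add_one (q * (p : ℚ) ^ m)
        rw [hfl] at this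
        simpa using this
      have h3 : q < d := lt_of_mul_lt_mul_right h2 hpm.le
      have h4 := hr (q - (d - δ - q₀)) ⟨hsupp, by
        rw [Set.mem_Iio]
        have : δ ≤ 1 := pow_le_one₀ (by positivity) ((div_lt_one (by linarith)).2 hp1).le
        linarith⟩ (fun h => hq (by linarith))
      linarith
    · rfl

/-- All components of `f - tr f` vanish: those outside `E_m` because of
`trace_onePlusRoot_mul_eq_zero`, those in `E_m` because `tr` is an `E_m`-linear projection. -/
theorem mem_levelField_of_le_valX (m k : ℕ) {f : completedField p E} {mu : ℝ}
    (hf : ∀ (j : ℕ) (γ : ℤ_[p]ˣ), k ≤ j → (γ : ℤ_[p]) = 1 + (p : ℤ_[p]) ^ j →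
      (((p : ℝ) ^ j / (p : ℝ) ^ m + mu : ℝ) : WithTop ℝ) ≤ valX p E (γ • f - f)) :
    (f : HahnSeries ℚ E) ∈ levelField p E m := by
  refine mem_levelField_iff_exists.2 ⟨laurentTrace p E m f, ?_⟩
  rw [← trace_apply]
  refine (sub_eq_zero.1 (eq_zero_of_trace_mul_eq_zero p E m fun s l => ?_)).symm
  by_cases hl : (p : ℤ_[p]) ^ s ∣ l
  · obtain ⟨b, hb⟩ := hl
    rw [hb, onePlusRoot_pow_mul, ← levelEmb_onePlusPow, trace_levelEmb_mul, map_sub, trace_apply,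
      trace_levelEmb, sub_self, mul_zero]
  · rw [mul_sub, map_sub, trace_onePlusRoot_mul_eq_zero p E m s l k hl hf, trace_apply p E m f,
      mul_comm, trace_levelEmb_mul, trace_onePlusRoot_of_not_dvd p E m s _ hl, mul_zero, sub_zero]

/-! ### The super-Hölder vectors -/

theorem mem_shVectorsOfLevel_iff (k : ℕ) (hk : 1 ≤ k) (m : ℕ) (f : completedField p E) :
    f ∈ shVectorsOfLevel p (valX p E) (gammaCoord p k hk) ((k : ℝ) - (m : ℝ)) ↔
      ∃ mu : ℝ, ∀ (i : ℕ) (x y : ℤ_[p]), (p : ℤ_[p]) ^ i ∣ x - y →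
        (((p : ℝ) ^ (k + i) / (p : ℝ) ^ m + mu : ℝ) : WithTop ℝ) ≤
          valX p E (((gammaCoord p k hk).symm x : ℤ_[p]ˣ) • f -
            ((gammaCoord p k hk).symm y : ℤ_[p]ˣ) • f) := by
  have h0 : (0 : ℝ) < p := by exact_mod_cast hp.out.pos
  have e : ∀ i : ℕ, (p : ℝ) ^ ((k : ℝ) - (m : ℝ)) * (p : ℝ) ^ i =
      (p : ℝ) ^ (k + i) / (p : ℝ) ^ m := by
    intro i
    rw [Real.rpow_sub h0, Real.rpow_natCast, Real.rpow_natCast, pow_add]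
    ring
  simp only [← e]
  exact Set.mem_iUnion

theorem shVectorsOfLevel_eq (k : ℕ) (hk : 1 ≤ k) (m : ℕ) :
    shVectorsOfLevel p (valX p E) (gammaCoord p k hk) ((k : ℝ) - (m : ℝ)) =
      {f : completedField p E | (f : HahnSeries ℚ E) ∈ levelField p E m} := by
  ext f
  rw [mem_shVectorsOfLevel_iff]
  constructor
  · rintro ⟨mu, hmu⟩
    refine mem_levelField_of_le_valX p E m k (mu := mu) fun j γ hj hγ => ?_
    obtain ⟨i, rfl⟩ := Nat.exists_eq_add_of_le hj
    have h1 : ((gammaCoord p k hk).symm ((p : ℤ_[p]) ^ i) : ℤ_[p]ˣ) = γ := Units.ext (by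
      rw [gammaCoord_symm_coe, hγ, pow_add])
    have h2 : ((gammaCoord p k hk).symm 0 : ℤ_[p]ˣ) = 1 := Units.ext (by
      rw [gammaCoord_symm_coe, mul_zero, add_zero, Units.val_one])
    have := hmu i ((p : ℤ_[p]) ^ i) 0 (by rw [sub_zero])
    rwa [h1, h2, one_smul] at this
  · intro hf
    obtain ⟨g, rfl⟩ := mem_levelField_iff_exists.1 hf
    obtain ⟨mu, hmu⟩ := exists_le_valX_smul_sub_smul p E m g
    refine ⟨mu, fun i x y hxy => hmu (k + i) _ _ ?_⟩
    rw [gammaCoord_symm_coe, gammaCoord_symm_coe, add_sub_add_left_eq_sub, ← mul_sub, pow_add]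
    exact mul_dvd_mul_left _ hxy

theorem shVectorsOfLevel_antitone {M : Type*} [AddCommGroup M] (v : M → WithTop ℝ) {G : Type*}
    [Group G] [MulAction G M] (c : G ≃ ℤ_[p]) : Antitone (shVectorsOfLevel p v c) := by
  intro lam lam' hle f hf
  obtain ⟨mu, hmu⟩ := Set.mem_iUnion.1 hf
  refine Set.mem_iUnion.2 ⟨mu, fun i x y hxy => le_trans ?_ (hmu i x y hxy)⟩
  have h1 : (1 : ℝ) ≤ p := by exact_mod_cast hp.out.one_lt.le
  have h2 := Real.rpow_le_rpow_of_exponent_le h1 hle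
  exact_mod_cast (by gcongr : (p : ℝ) ^ lam * (p : ℝ) ^ i + mu ≤ (p : ℝ) ^ lam' * (p : ℝ) ^ i + mu)

end CharP

end SuperHolder

end

theorem mainTheorem1 (p : ℕ) [Fact p.Prime] (E : Type*) [Field E] [CharP E p]
    (k : ℕ) (hk : 1 ≤ k) (hk2 : p = 2 → 2 ≤ k) :
    (∀ m : ℕ,
      SuperHolder.shVectorsOfLevel p (SuperHolder.valX p E) (SuperHolder.gammaCoord p k hk)
          ((k : ℝ) - (m : ℝ)) =
        {f : SuperHolder.completedField p E |
          (f : HahnSeries ℚ E) ∈ SuperHolder.levelField p E m}) ∧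
      SuperHolder.shVectors p (SuperHolder.valX p E) (SuperHolder.gammaCoord p k hk) =
        {f : SuperHolder.completedField p E |
          (f : HahnSeries ℚ E) ∈ SuperHolder.perfField p E} := by
  refine ⟨SuperHolder.shVectorsOfLevel_eq p E k hk, Set.Subset.antisymm ?_ ?_⟩
  · intro f hf
    obtain ⟨lam, hlam⟩ := Set.mem_iUnion.1 hf
    obtain ⟨m, hm⟩ := exists_nat_ge ((k : ℝ) - lam)
    have h := SuperHolder.shVectorsOfLevel_antitone p (SuperHolder.valX p E)
      (SuperHolder.gammaCoord p k hk) (by linarith : (k : ℝ) - m ≤ lam) hlam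
    rw [SuperHolder.shVectorsOfLevel_eq] at h
    exact Set.mem_iUnion.2 ⟨m, h⟩
  · intro f hf
    obtain ⟨m, hm⟩ := Set.mem_iUnion.1 hf
    refine Set.mem_iUnion.2 ⟨(k : ℝ) - m, ?_⟩
    rw [SuperHolder.shVectorsOfLevel_eq]
    exact hm
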